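/- Let $q\ge 4$ be a prime power and let $\mathcal H_q$ be the Hermitian curve over $\mathbb F_{q^2}$ with homogeneous equation $X_2^qX_3+X_2X_3^q-X_1^{q+1}=0$ and affine equation $y^q+y=x^{q+1}$, where $x=X_1/X_3$, $y=X_2/X_3$. Let $P_2,\dots,P_q$ be the points $(0:b:1)$ with $b^q+b=0$, $b\neq 0$ (the points of $\mathcal H_q$ on the line $X_1=0$ other than $(0:0:1)$ and $(0:1:0)$), and for an integer $2\le m\le q-1$ put $\mathtt G=m(P_2+\dots+P_q)$. Let $\omega$ be a generator of $\mathbb F_{q^2}^*$, let $u,v\in\mathbb F_{q^2}$ with $u\ne 0$ and $v^q+v=u^{q+1}$, let $Q_i=(\omega^iu:\omega^{(q+1)i}v:1)$ for $i=1,\dots,q^2-1$, and put $D=\{Q_1,\dots,Q_{q^2-1}\}$ and $\mathtt D=Q_1+\dots+Q_{q^2-1}$. Let $\mathcal L(\mathtt G)=\{f\in\mathbb F_{q^2}(x,y) : f=0 \text{ or } \operatorname{div}(f)+\mathtt G\succcurlyeq 0\}$ and $$C_{\mathcal L}(\mathtt D,\mathtt G)=\{(f(Q_1),\dots,f(Q_{q^2-1}))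 : f\in\mathcal L(\mathtt G)\}\subseteq \mathbb F_{q^2}^{\,q^2-1}.$$ If $m=3$, then the minimum distance of $C_{\mathcal L}(\mathtt D,\mathtt G)$ equals $q^2-q-2$; that is, it attains the upper bound $q^2-1-(m-2)(q+1)$. Moreover, every curve $X_2X_3\,g(X_1,X_2,X_3)+\varepsilon X_1^3=0$, where $\varepsilon\in\mathbb F_{q^2}$, $g\in\mathbb F_{q^2}[X_1,X_2,X_3]$ is zero or homogeneous of degree $1$, and the left-hand side is not the zero polynomial, meets $D$ in at most $q+1$ points. -/

import Mathlib

open scoped Polynomial LinearAlgebra.Projectivization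

noncomputable section

namespace HermitianCode

/-! ### The Hermitian curve and its points over the algebraic closure -/

/-- The form `X₂^q X₃ + X₂ X₃^q - X₁^(q+1)`; the coordinates `X₁, X₂, X₃` are the variables
`X 0, X 1, X 2`. -/
def hermitianForm (q : ℕ) (F : Type*) [Field F] : MvPolynomial (Fin 3) F :=
  MvPolynomial.X 1 ^ q * MvPolynomial.X 2 + MvPolynomial.X 1 * MvPolynomial.X 2 ^ q
    - MvPolynomial.X 0 ^ (q + 1)

/-- A homogeneous form with coefficients in `F` vanishes at a point of the projective plane over
the algebraic closure of `F`. -/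
def Vanishes {F : Type*} [Field F] (a : MvPolynomial (Fin 3) F)
    (P : ℙ (AlgebraicClosure F) (Fin 3 → AlgebraicClosure F)) : Prop :=
  MvPolynomial.aeval P.rep a = 0

/-- The points of the Hermitian curve in the projective plane over the algebraic closure. -/
def Point (q : ℕ) (F : Type*) [Field F] : Type _ :=
  {P : ℙ (AlgebraicClosure F) (Fin 3 → AlgebraicClosure F) // Vanishes (hermitianForm q F) P}

theorem affineVec_ne_zero {F : Type*} [Field F] (a b : F) :
    ![algebraMap F (AlgebraicClosure F) a, algebraMap F (AlgebraicClosure F) b, 1] ≠ 0 :=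
  fun h => by simpa using congrFun h 2

/-- The affine point `(a : b : 1)` of the projective plane, with `a, b ∈ F`. -/
def affineProj {F : Type*} [Field F] (a b : F) :
    ℙ (AlgebraicClosure F) (Fin 3 → AlgebraicClosure F) :=
  Projectivization.mk (AlgebraicClosure F)
    ![algebraMap F (AlgebraicClosure F) a, algebraMap F (AlgebraicClosure F) b, 1]
    (affineVec_ne_zero a b)

theorem affineProj_vanishes (q : ℕ) {F : Type*} [Field F] {a b : F}
    (h : b ^ q + b = a ^ (q + 1)) : Vanishes (hermitianForm q F) (affineProj a b) := by
  obtain ⟨c, hc⟩ := Projectivization.exists_smul_eq_mk_rep (AlgebraicClosure F)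
    (![algebraMap F (AlgebraicClosure F) a, algebraMap F (AlgebraicClosure F) b, 1])
    (affineVec_ne_zero a b)
  have h' := congrArg (algebraMap F (AlgebraicClosure F)) h
  simp only [map_add, map_pow] at h'
  unfold Vanishes affineProj hermitianForm
  rw [← hc]
  simp only [map_sub, map_add, map_mul, map_pow, MvPolynomial.aeval_X, Pi.smul_apply,
    Units.smul_def, smul_eq_mul, Matrix.cons_val_zero, Matrix.cons_val_one, Matrix.cons_val]
  linear_combination (c : AlgebraicClosure F) ^ (q + 1) * h'

/-- The affine `F`-rational point `(a : b : 1)` of the Hermitian curve. -/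
def affinePoint (q : ℕ) {F : Type*} [Field F] (a b : F) (h : b ^ q + b = a ^ (q + 1)) :
    Point q F :=
  ⟨affineProj a b, affineProj_vanishes q h⟩

/-! ### The function field `F(x, y)`, `y^q + y = x^(q+1)` -/

/-- The affine equation `X^(q+1) - (Y^q + Y)`, as a polynomial in `X` over `F[Y]`. -/
def affineEquation (q : ℕ) (F : Type*) [Field F] : F[X][X] :=
  Polynomial.X ^ (q + 1) - Polynomial.C (Polynomial.X ^ q + Polynomial.X)

/-- The affine equation is irreducible, so the coordinate ring below is a domain. -/
theorem affineEquation_irreducible {q : ℕ} (hq : 2 ≤ q) (F : Type*) [Field F] :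
    Irreducible (affineEquation q F) := by
  have hm : (affineEquation q F).Monic := Polynomial.monic_X_pow_sub_C _ (Nat.succ_ne_zero q)
  have hd : (affineEquation q F).natDegree = q + 1 := Polynomial.natDegree_X_pow_sub_C
  have hp : (Ideal.span {(Polynomial.X : F[X])}).IsPrime :=
    (Ideal.span_singleton_prime Polynomial.X_ne_zero).2 Polynomial.prime_X
  have hcoeff : ∀ n < q + 1, (affineEquation q F).coeff n =
      if n = 0 then -(Polynomial.X ^ q + Polynomial.X) else 0 := by
    intro n hn
    simp only [affineEquation, Polynomial.coeff_sub, Polynomial.coeff_X_pow, Polynomial.coeff_C]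
    rw [if_neg hn.ne]
    split_ifs <;> simp
  refine Polynomial.irreducible_of_eisenstein_criterion hp ?_ ?_ ?_ ?_ hm.isPrimitive
  · rw [hm.leadingCoeff]
    exact fun h => hp.ne_top ((Ideal.eq_top_iff_one _).2 h)
  · intro n hn
    rw [Polynomial.degree_eq_natDegree hm.ne_zero, hd] at hn
    rw [hcoeff n (by exact_mod_cast hn), Ideal.mem_span_singleton]
    split_ifs
    · exact (dvd_add (dvd_pow_self _ (by omega)) dvd_rfl).neg_right
    · exact dvd_zero _
  · rw [← Polynomial.natDegree_pos_iff_degree_pos, hd]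
    omega
  · rw [hcoeff 0 (by omega), if_pos rfl, Ideal.span_singleton_pow, Ideal.mem_span_singleton,
      dvd_neg, dvd_add_right (pow_dvd_pow _ hq), Polynomial.X_pow_dvd_iff]
    intro h
    simpa using h 1 one_lt_two

/-- The affine coordinate ring `F[X, Y] / (Y^q + Y - X^(q+1))`. -/
abbrev CoordRing (q : ℕ) (F : Type*) [Field F] : Type _ := AdjoinRoot (affineEquation q F)

/-- The field of functions on the Hermitian curve that are defined over `F`. -/
abbrev FunField (q : ℕ) (F : Type*) [Field F] : Type _ := FractionRing (CoordRing q F)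

/-- The coordinate function `x`. -/
def coordX (q : ℕ) (F : Type*) [Field F] : FunField q F :=
  algebraMap (CoordRing q F) (FunField q F) (AdjoinRoot.root (affineEquation q F))

/-- The coordinate function `y`. -/
def coordY (q : ℕ) (F : Type*) [Field F] : FunField q F :=
  algebraMap (CoordRing q F) (FunField q F)
    (AdjoinRoot.of (affineEquation q F) Polynomial.X)

/-- The function `a(x, y, 1)`. -/
def dehom (q : ℕ) {F : Type*} [Field F] (a : MvPolynomial (Fin 3) F) : FunField q F :=
  MvPolynomial.aeval ![coordX q F, coordY q F, 1] a

/-- The local ring at `P`: the functions `a(x, y, 1) / b(x, y, 1)` with `a, b` homogeneous of the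
same degree and `b(P) ≠ 0`. -/
def localRing {q : ℕ} {F : Type*} [Field F] (P : Point q F) : Subalgebra F (FunField q F) where
  carrier := {f | ∃ (d : ℕ) (a b : MvPolynomial (Fin 3) F), a.IsHomogeneous d ∧
    b.IsHomogeneous d ∧ ¬ Vanishes b P.1 ∧ f * dehom q b = dehom q a}
  mul_mem' := by
    rintro f g ⟨d, a, b, ha, hb, hbP, h⟩ ⟨e, a', b', ha', hb', hbP', h'⟩
    refine ⟨d + e, a * a', b * b', ha.mul ha', hb.mul hb', ?_, ?_⟩
    · simpa [Vanishes] using And.intro hbP hbP'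
    · simp only [dehom, map_mul] at *
      rw [← h, ← h']; ring
  add_mem' := by
    rintro f g ⟨d, a, b, ha, hb, hbP, h⟩ ⟨e, a', b', ha', hb', hbP', h'⟩
    refine ⟨d + e, a * b' + b * a', b * b', (ha.mul hb').add (hb.mul ha'), hb.mul hb', ?_, ?_⟩
    · simpa [Vanishes] using And.intro hbP hbP'
    · simp only [dehom, map_mul, map_add] at *
      rw [← h, ← h']; ring
  algebraMap_mem' c := by
    refine ⟨0, MvPolynomial.C c, 1, MvPolynomial.isHomogeneous_C _ _,
      MvPolynomial.isHomogeneous_one _ _, by simp [Vanishes], ?_⟩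
    simp [dehom]

/-- The maximal ideal of the local ring at `P`, as a submodule of the function field: the
functions `a(x, y, 1) / b(x, y, 1)` as above with moreover `a(P) = 0`. -/
def maxIdeal {q : ℕ} {F : Type*} [Field F] (P : Point q F) :
    Submodule (localRing P) (FunField q F) where
  carrier := {f | ∃ (d : ℕ) (a b : MvPolynomial (Fin 3) F), a.IsHomogeneous d ∧
    b.IsHomogeneous d ∧ ¬ Vanishes b P.1 ∧ Vanishes a P.1 ∧ f * dehom q b = dehom q a}
  zero_mem' := ⟨0, 0, 1, MvPolynomial.isHomogeneous_zero _ _ _,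
    MvPolynomial.isHomogeneous_one _ _, by simp [Vanishes], by simp [Vanishes], by simp [dehom]⟩
  add_mem' := by
    rintro f g ⟨d, a, b, ha, hb, hbP, haP, h⟩ ⟨e, a', b', ha', hb', hbP', haP', h'⟩
    refine ⟨d + e, a * b' + b * a', b * b', (ha.mul hb').add (hb.mul ha'), hb.mul hb', ?_, ?_, ?_⟩
    · simpa [Vanishes] using And.intro hbP hbP'
    · simp only [Vanishes, map_add, map_mul] at *
      rw [haP, haP']; ring
    · simp only [dehom, map_mul, map_add] at *
      rw [← h, ← h']; ring
  smul_mem' := by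
    rintro ⟨f, d, a, b, ha, hb, hbP, h⟩ g ⟨e, a', b', ha', hb', hbP', haP', h'⟩
    refine ⟨d + e, a * a', b * b', ha.mul ha', hb.mul hb', ?_, ?_, ?_⟩
    · simpa [Vanishes] using And.intro hbP hbP'
    · simp only [Vanishes, map_mul] at *
      rw [haP']; ring
    · simp only [dehom, map_mul, Subalgebra.smul_def, smul_eq_mul] at h h' ⊢
      rw [← h, ← h']; ring

/-! ### Divisors, Riemann–Roch spaces and codes -/

/-- The functions `f` with `ord_P f ≥ n` (and `f = 0`), that is the power `𝔪_P ^ n` of the maximal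
ideal of the local ring at `P`; for `n = -k < 0` this is `{f | f * 𝔪_P ^ k ⊆ 𝒪_P}`.
(The curve is smooth, so the local ring is a discrete valuation ring.) -/
def ordGE {q : ℕ} {F : Type*} [Field F] (P : Point q F) :
    ℤ → Submodule (localRing P) (FunField q F)
  | Int.ofNat n => maxIdeal P ^ n
  | Int.negSucc n => 1 / maxIdeal P ^ (n + 1)

/-- The Riemann–Roch space `ℒ(G) = {f | div f + G ≥ 0}` of functions defined over `F`. -/
def riemannRoch {q : ℕ} {F : Type*} [Field F] (G : Point q F →₀ ℤ) :
    Submodule F (FunField q F) :=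
  ⨅ P : Point q F, (ordGE P (-(G P))).restrictScalars F

/-- The function `f` is regular at `P` and takes there the value `c ∈ F`. -/
def HasValue {q : ℕ} {F : Type*} [Field F] (P : Point q F) (f : FunField q F) (c : F) : Prop :=
  f - algebraMap F (FunField q F) c ∈ maxIdeal P

/-- The functional code `C_ℒ(D, G)`: all words `(f(Q₁), …, f(Qₙ))` with `f ∈ ℒ(G)`, where
`D = (Q₁, …, Qₙ)`. -/
def agCode {q n : ℕ} {F : Type*} [Field F] (D : Fin n → Point q F) (G : Point q F →₀ ℤ) :
    Submodule F (Fin n → F) where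
  carrier := {w | ∃ f ∈ riemannRoch G, ∀ i, HasValue (D i) f (w i)}
  zero_mem' := ⟨0, Submodule.zero_mem _, fun i => by simp [HasValue]⟩
  add_mem' := by
    rintro w w' ⟨f, hf, h⟩ ⟨f', hf', h'⟩
    refine ⟨f + f', Submodule.add_mem _ hf hf', fun i => ?_⟩
    have := Submodule.add_mem _ (h i) (h' i)
    simp only [HasValue, Pi.add_apply, map_add]
    convert this using 1; ring
  smul_mem' := by
    rintro c w ⟨f, hf, h⟩
    refine ⟨c • f, Submodule.smul_mem _ c hf, fun i => ?_⟩
    have := ((maxIdeal (D i)).restrictScalars F).smul_mem c (h i)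
    simp only [HasValue, Pi.smul_apply, smul_eq_mul, map_mul]
    rw [smul_sub, Algebra.smul_def c (algebraMap F (FunField q F) (w i))] at this
    exact this

/-- `d` is the minimum distance of the code `C`. -/
def IsMinDistance {n : ℕ} {F : Type*} [Field F] [DecidableEq F] (C : Submodule F (Fin n → F))
    (d : ℕ) : Prop :=
  IsLeast {e | ∃ w ∈ C, ∃ w' ∈ C, w ≠ w' ∧ hammingDist w w' = e} d

/-! ### The divisors `G` and `D` -/

/-- `G = m (P₂ + ⋯ + P_q)`, where `P₂, …, P_q` are the points `(0 : b : 1)` with `b^q + b = 0` and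
`b ≠ 0`, that is the points of the curve on the line `X₁ = 0` other than `(0 : 0 : 1)` and
`(0 : 1 : 0)`. -/
def divG (q : ℕ) (F : Type*) [Field F] [Fintype F] [DecidableEq F] (m : ℕ) : Point q F →₀ ℤ :=
  ∑ b : {b : F // b ^ q + b = 0 ∧ b ≠ 0},
    Finsupp.single (affinePoint q 0 b.1 (by rw [b.2.1, zero_pow (Nat.succ_ne_zero q)])) (m : ℤ)

theorem orbit_eq {q : ℕ} {F : Type*} [Field F] [Fintype F] (hF : Fintype.card F = q ^ 2)
    {u v : F} (huv : v ^ q + v = u ^ (q + 1)) (w : F) :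
    (w ^ (q + 1) * v) ^ q + w ^ (q + 1) * v = (w * u) ^ (q + 1) := by
  have h : w ^ (q ^ 2) = w := hF ▸ FiniteField.pow_card w
  have h2 : (w ^ (q + 1)) ^ q = w ^ (q + 1) := by
    rw [← pow_mul, show (q + 1) * q = q ^ 2 + q by ring, pow_add, h, pow_succ']
  rw [mul_pow, h2, mul_pow, ← huv]; ring

/-- The points `Qᵢ = (ω^i u : ω^((q+1)i) v : 1)`, `i = 1, …, q² - 1`. -/
def divD {q : ℕ} {F : Type*} [Field F] [Fintype F] (hF : Fintype.card F = q ^ 2) (ω : Fˣ)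
    {u v : F} (huv : v ^ q + v = u ^ (q + 1)) (i : Fin (q ^ 2 - 1)) : Point q F :=
  affinePoint q ((ω : F) ^ ((i : ℕ) + 1) * u) (((ω : F) ^ ((i : ℕ) + 1)) ^ (q + 1) * v)
    (orbit_eq hF huv _)

/-- The forms `X₂ X₃ g + ε X₁^m` over `F`, with `g` homogeneous of degree `m - 2`, that are not
identically zero: the equations of the curves (defined over `F`) of the linear system. -/
def linearSystem (F : Type*) [Field F] (m : ℕ) : Set (MvPolynomial (Fin 3) F) :=
  {V | V ≠ 0 ∧ ∃ (g : MvPolynomial (Fin 3) F) (ε : F), g.IsHomogeneous (m - 2) ∧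
    V = MvPolynomial.X 1 * MvPolynomial.X 2 * g + MvPolynomial.C ε * MvPolynomial.X 0 ^ m}

end HermitianCode

end

/-!
Write `x = X₁ / X₃` and `y = X₂ / X₃`. At every affine rational point `(0 : b : 1)` the function
`x` is a local parameter. If `f ∈ ℒ(m (P₂ + ⋯ + P_q))`, then `f x^m` is regular on the affine curve,
is divisible by `x^m` at the origin, and has a pole of order at most `m q` at `(0 : 1 : 0)`. In the
basis `x^i y^j`, `i ≤ q`, divisibility at the origin kills the pure powers `x^i` with `i < m`, the
bound at infinity leaves the monomials with `q (i + j) + j ≤ m q`, and so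
`f = (y g + ε x^m) / x^m` with `deg g ≤ m - 2`. Conversely such functions belong to the space,
because `x^(q+1) = y (y^(q-1) + 1)`. The zeros of a codeword are therefore the points of `D` on a
curve `X₂ X₃ g + ε X₁^m = 0`.

For `m = 3`, the point of the orbit with parameter `w` lies on such a curve if and only if
`A w^(q+1) + B w^(q+2) + D w^(2q+2) + E w^3 = 0`. If `D = 0` or `E = 0`, cancelling a power of `w`
leaves a polynomial of degree at most `q + 1`. Otherwise, dividing by `w` and raising to the power
`q` gives a second cubic relation between `w` and `w^q`, and eliminating `w^q` leaves degree `6`,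
which suffices for `q ≥ 5`; for `q = 4` squaring the relation leaves degree `5`.
-/

namespace HermitianCode

/-! ### Polynomial relations over a field of square order -/

section FiniteField

open Polynomial

theorem card_le_of_forall_eval_eq_zero {R : Type*} [CommRing R] [IsDomain R] {S : Finset R}
    {p : R[X]} (hp : p ≠ 0) {n : ℕ} (hn : p.natDegree ≤ n) (hS : ∀ w ∈ S, p.eval w = 0) :
    S.card ≤ n :=
  (card_le_degree_of_subset_roots fun w hw => (mem_roots hp).2 (hS w hw)).trans hn

theorem card_le_of_forall_trinomial_eq_zero {R : Type*} [CommRing R] [IsDomain R] {A B D : R}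
    {S : Finset R} {q : ℕ} (hq : q ≠ 0) (hABD : ¬(A = 0 ∧ B = 0 ∧ D = 0))
    (hS : ∀ w ∈ S, A + B * w + D * w ^ (q + 1) = 0) : S.card ≤ q + 1 := by
  set r : R[X] := C A + C B * X + C D * X ^ (q + 1) with hr
  have hr₀ : r ≠ 0 := by
    intro h
    have hA : r.coeff 0 = A := by simp [hr, coeff_X_pow]
    have hB : r.coeff 1 = B := by simp [hr, coeff_X_pow, coeff_C, hq]
    have hD : r.coeff (q + 1) = D := by simp [hr, coeff_C, hq]
    rw [h, coeff_zero] at hA hB hD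
    exact hABD ⟨hA.symm, hB.symm, hD.symm⟩
  exact card_le_of_forall_eval_eq_zero hr₀ (by rw [hr]; compute_degree!) fun w hw => by
    simpa [hr] using hS w hw

/-- Writing `k(w) = -DD'w³ - DB'w² + E'Bw + E'A` and `ℓ = DA' - EE'`, the two equations give
`t k(w) = ℓ w²`; substituting this into `k(w)²` times the second one eliminates `t`. -/
theorem exists_eliminant_of_cubics {K : Type*} [Field K] (A B A' B' : K) {D E D' E' : K}
    (hD : D ≠ 0) (hE : E ≠ 0) (hD' : D' ≠ 0) (hE' : E' ≠ 0) :
    ∃ p : K[X], p ≠ 0 ∧ p.natDegree ≤ 6 ∧ ∀ w t : K, w ≠ 0 →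
      A * t + B * (t * w) + D * (t ^ 2 * w) + E * w ^ 2 = 0 →
      A' * w + B' * (w * t) + D' * (w ^ 2 * t) + E' * t ^ 2 = 0 → p.eval w = 0 := by
  set l : K := D * A' - E * E' with hl
  set M : K[X] := C (-(D * B')) * X ^ 2 + C (E' * B) * X + C (E' * A) with hM
  set r : K[X] := C (D' * l) * X ^ 3 * M + C (E' * l ^ 2) * X ^ 3
    + C (B' * l) * X ^ 2 * (C (-(D * D')) * X ^ 3 + M)
    + C A' * (C (-(2 * D * D')) * X ^ 3 * M + M ^ 2) with hr
  have hr5 : r.natDegree ≤ 5 := by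
    rw [hr, hM]
    compute_degree
  refine ⟨C (D * D' ^ 2 * E * E') * X ^ 6 + r, fun h => ?_, ?_, fun w t hw h₁ h₂ => ?_⟩
  · have hlead := congrArg (coeff · 6) h
    rw [coeff_add, coeff_C_mul_X_pow, if_pos rfl, coeff_eq_zero_of_natDegree_lt (by omega),
      add_zero, coeff_zero] at hlead
    simp_all
  · exact natDegree_add_le_of_degree_le (natDegree_C_mul_X_pow_le _ _) (hr5.trans (by norm_num))
  · set k : K := -(D * D') * w ^ 3 + M.eval w with hk
    have hkl : t * k = l * w ^ 2 := by
      simp only [hk, hM, hl, eval_add, eval_mul, eval_C, eval_pow, eval_X]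
      linear_combination E' * h₁ - D * w * h₂
    refine (mul_eq_zero.1 (?_ : w * _ = 0)).resolve_left hw
    have hM' : M.eval w = k + D * D' * w ^ 3 := by rw [hk]; ring
    simp only [hr, eval_add, eval_mul, eval_C, eval_pow, eval_X, hM']
    linear_combination k ^ 2 * h₂
      - (D' * w ^ 2 * k + B' * w * k + E' * (t * k + l * w ^ 2)) * hkl
        - D * D' ^ 2 * w ^ 7 * hl

variable {F : Type*} [Field F] [Fintype F] {q n : ℕ}

theorem exists_eq_prime_pow_of_card_eq_pow (hn : n ≠ 0) (hF : Fintype.card F = q ^ n) :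
    ∃ p k : ℕ, p.Prime ∧ CharP F p ∧ q = p ^ k := by
  obtain ⟨p, hp⟩ := CharP.exists F
  obtain ⟨l, hpp, hl⟩ := FiniteField.card F p
  have hdvd : q ∣ p ^ (l : ℕ) := by
    rw [← hl, hF]
    exact dvd_pow_self _ hn
  obtain ⟨k, -, hk⟩ := (Nat.dvd_prime_pow hpp).1 hdvd
  exact ⟨p, k, hpp, hp, hk⟩

theorem add_pow_of_card_eq_pow (hn : n ≠ 0) (hF : Fintype.card F = q ^ n) {R : Type*}
    [CommRing R] [Algebra F R] (a b : R) : (a + b) ^ q = a ^ q + b ^ q := by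
  obtain ⟨p, k, hp, hc, rfl⟩ := exists_eq_prime_pow_of_card_eq_pow hn hF
  rcases subsingleton_or_nontrivial R with _ | _
  · exact Subsingleton.elim _ _
  have : Fact p.Prime := ⟨hp⟩
  have : CharP R p := charP_of_injective_algebraMap (algebraMap F R).injective p
  exact add_pow_char_pow a b p k

theorem sub_pow_of_card_eq_pow (hn : n ≠ 0) (hF : Fintype.card F = q ^ n) {R : Type*}
    [CommRing R] [Algebra F R] (a b : R) : (a - b) ^ q = a ^ q - b ^ q := by
  rw [eq_sub_iff_add_eq, ← add_pow_of_card_eq_pow hn hF, sub_add_cancel]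

theorem mem_range_algebraMap_of_pow_card {L : Type*} [Field L] [Algebra F L] {b : L}
    (hb : b ^ Fintype.card F = b) : b ∈ Set.range (algebraMap F L) := by
  have hsplit : (X ^ Fintype.card F - X : F[X]).Splits := by
    simpa using (FiniteField.isSplittingField_sub F F).splits
  exact hsplit.mem_range_of_isRoot (FiniteField.X_pow_card_sub_X_ne_zero F Fintype.one_lt_card)
    (by simp [hb])

variable {A B D E : F} {S : Finset F}

theorem card_le_six_of_cubic (hF : Fintype.card F = q ^ 2) (hD : D ≠ 0) (hE : E ≠ 0)
    (hS₀ : ∀ w ∈ S, w ≠ 0)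
    (hS : ∀ w ∈ S, A * w ^ q + B * w ^ (q + 1) + D * w ^ (2 * q + 1) + E * w ^ 2 = 0) :
    S.card ≤ 6 := by
  have hq : q ≠ 0 := by
    rintro rfl
    simp at hF
  obtain ⟨p, hp, hdeg, hroot⟩ := exists_eliminant_of_cubics A B (A ^ q) (B ^ q) hD hE
    (pow_ne_zero q hD) (pow_ne_zero q hE)
  refine card_le_of_forall_eval_eq_zero hp hdeg fun w hw => ?_
  have hconj : (w ^ q) ^ q = w := by rw [← pow_mul, ← sq, ← hF, FiniteField.pow_card]
  have h₁ : A * w ^ q + B * (w ^ q * w) + D * ((w ^ q) ^ 2 * w) + E * w ^ 2 = 0 := by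
    rw [← hS w hw]
    ring
  refine hroot w (w ^ q) (hS₀ w hw) h₁ ?_
  have h₂ := congrArg (· ^ q) h₁
  simpa only [add_pow_of_card_eq_pow two_ne_zero hF, mul_pow, pow_right_comm _ 2 q, hconj,
    zero_pow hq] using h₂

/-- In characteristic `2` the relation squares term by term; reducing `Dw` times its square modulo
the relation itself and `w¹⁵ = 1` leaves a polynomial of degree `5`. -/
theorem card_le_five_of_card_eq_sixteen (hF : Fintype.card F = 16) (hD : D ≠ 0) (hE : E ≠ 0)
    (hS₀ : ∀ w ∈ S, w ≠ 0) (hS : ∀ w ∈ S, A * w ^ 2 + B * w ^ 3 + D * w ^ 7 + E = 0) :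
    S.card ≤ 5 := by
  have : CharP F 2 := charP_of_card_eq_prime_pow (f := 4) hF
  set r : F[X] := C (D * A ^ 2) * X ^ 5 + C (B ^ 3) * X ^ 3 + C (A * B ^ 2) * X ^ 2
    + C (D * E ^ 2) * X + C (D ^ 3 + B ^ 2 * E) with hr
  have hr₁ : r.coeff 1 = D * E ^ 2 := by
    simp only [hr, coeff_add, coeff_C_mul, coeff_X_pow, coeff_X_one, coeff_C]
    norm_num
  have hr₀ : r ≠ 0 := by
    intro h
    rw [h, coeff_zero] at hr₁
    exact mul_ne_zero hD (pow_ne_zero _ hE) hr₁.symm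
  refine card_le_of_forall_eval_eq_zero hr₀ (by rw [hr]; compute_degree) fun w hw => ?_
  have hsq : A ^ 2 * w ^ 4 + B ^ 2 * w ^ 6 + D ^ 2 * w ^ 14 + E ^ 2 = 0 := by
    have := congrArg (· ^ 2) (hS w hw)
    simpa only [CharTwo.add_sq, mul_pow, ← pow_mul, zero_pow two_ne_zero] using this
  have h15 : w ^ 15 = 1 := by
    simpa only [hF] using FiniteField.pow_card_sub_one_eq_one w (hS₀ w hw)
  simp only [hr, eval_add, eval_mul, eval_C, eval_pow, eval_X]
  linear_combination D * w * hsq + B ^ 2 * hS w hw - D ^ 3 * h15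
    - D * B ^ 2 * w ^ 7 * CharTwo.two_eq_zero (R := F)

theorem card_le_of_forall_quadrinomial_eq_zero (hq : 4 ≤ q) (hF : Fintype.card F = q ^ 2)
    (h₀ : ¬(A = 0 ∧ B = 0 ∧ D = 0 ∧ E = 0)) (hS₀ : ∀ w ∈ S, w ≠ 0)
    (hS : ∀ w ∈ S, A * w ^ (q + 1) + B * w ^ (q + 2) + D * w ^ (2 * q + 2) + E * w ^ 3 = 0) :
    S.card ≤ q + 1 := by
  obtain ⟨s, rfl⟩ : ∃ s, q = s + 2 := ⟨q - 2, by omega⟩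
  have hcancel : ∀ {w c : F} (n : ℕ), w ∈ S → w ^ n * c = 0 → c = 0 := fun n hw h =>
    (mul_eq_zero.1 h).resolve_left (pow_ne_zero n (hS₀ _ hw))
  by_cases hE : E = 0
  · refine card_le_of_forall_trinomial_eq_zero (A := A) (B := B) (D := D) (by omega)
      (fun h => h₀ ⟨h.1, h.2.1, h.2.2, hE⟩) fun w hw => hcancel (s + 3) hw ?_
    rw [← hS w hw, hE]
    ring
  by_cases hD : D = 0
  · set r : F[X] := C A * X ^ s + C B * X ^ (s + 1) + C E with hr
    have hr₀ : r.eval 0 = E := by simp [hr, show s ≠ 0 by omega]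
    refine card_le_of_forall_eval_eq_zero (p := r) (fun h => hE (by rw [← hr₀, h, eval_zero]))
      (by rw [hr]; compute_degree; omega) fun w hw => hcancel 3 hw ?_
    simp only [hr, eval_add, eval_mul, eval_C, eval_pow, eval_X]
    rw [← hS w hw, hD]
    ring
  rcases hq.eq_or_lt with hs | hs
  · obtain rfl : s = 2 := by omega
    refine (card_le_five_of_card_eq_sixteen (A := A) (B := B) hF hD hE hS₀ fun w hw =>
      hcancel 3 hw ?_)
    rw [← hS w hw]
    ring
  · refine (card_le_six_of_cubic (A := A) (B := B) hF hD hE hS₀ fun w hw =>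
      hcancel 1 hw ?_).trans (by omega)
    rw [← hS w hw]
    ring

end FiniteField

/-! ### The coordinate ring and the points of the curve -/

section Points

open MvPolynomial (aeval eval)

theorem aeval_smul_of_isHomogeneous {R A σ : Type*} [CommSemiring R] [CommSemiring A] [Algebra R A]
    {p : MvPolynomial σ R} {d : ℕ} (hp : p.IsHomogeneous d) (c : A) (x : σ → A) :
    aeval (c • x) p = c ^ d * aeval x p := by
  simp only [MvPolynomial.aeval_def, MvPolynomial.eval₂_eq, Finset.mul_sum]
  refine Finset.sum_congr rfl fun m hm => ?_
  have hd : m.degree = d := by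
    rw [Finsupp.degree_eq_weight_one]
    exact hp (MvPolynomial.mem_support_iff.1 hm)
  simp only [Pi.smul_apply, smul_eq_mul, mul_pow, Finset.prod_mul_distrib]
  rw [Finset.prod_pow_eq_pow_sum, ← Finsupp.degree_apply, hd]
  ring

variable {q : ℕ} {F : Type*} [Field F]

theorem vanishes_mk_iff {a : MvPolynomial (Fin 3) F} {d : ℕ} (ha : a.IsHomogeneous d)
    {x : Fin 3 → AlgebraicClosure F} (hx : x ≠ 0) :
    Vanishes a (Projectivization.mk (AlgebraicClosure F) x hx) ↔ aeval x a = 0 := by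
  obtain ⟨c, hc⟩ := Projectivization.exists_smul_eq_mk_rep (AlgebraicClosure F) x hx
  rw [Vanishes, ← hc, Units.smul_def, aeval_smul_of_isHomogeneous ha, mul_eq_zero]
  simp

theorem isHomogeneous_hermitianForm (q : ℕ) (F : Type*) [Field F] :
    (hermitianForm q F).IsHomogeneous (q + 1) := by
  have hX := MvPolynomial.isHomogeneous_X (σ := Fin 3) F
  refine .sub (.add ?_ ?_) ?_
  · simpa using ((hX 1).pow q).mul (hX 2)
  · simpa [add_comm] using (hX 1).mul ((hX 2).pow q)
  · simpa using (hX 0).pow (q + 1)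

/-- The coordinate function `x`, as an element of the coordinate ring. -/
noncomputable def ringX (q : ℕ) (F : Type*) [Field F] : CoordRing q F :=
  AdjoinRoot.root (affineEquation q F)

/-- The coordinate function `y`, as an element of the coordinate ring. -/
noncomputable def ringY (q : ℕ) (F : Type*) [Field F] : CoordRing q F :=
  AdjoinRoot.of (affineEquation q F) Polynomial.X

theorem ringX_pow (q : ℕ) (F : Type*) [Field F] :
    ringX q F ^ (q + 1) = ringY q F ^ q + ringY q F := by
  have h := AdjoinRoot.mk_self (f := affineEquation q F)
  rw [affineEquation] at h
  simp only [map_sub, map_pow, AdjoinRoot.mk_X, AdjoinRoot.mk_C, map_add] at h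
  exact sub_eq_zero.1 h

/-- Dehomogenization `a ↦ a(x, y, 1)` with values in the coordinate ring. -/
noncomputable def ringDehom (q : ℕ) {F : Type*} [Field F] :
    MvPolynomial (Fin 3) F →ₐ[F] CoordRing q F :=
  aeval ![ringX q F, ringY q F, 1]

theorem ringDehom_X_zero : ringDehom q (MvPolynomial.X 0 : MvPolynomial _ F) = ringX q F := by
  simp [ringDehom]

theorem ringDehom_X_one : ringDehom q (MvPolynomial.X 1 : MvPolynomial _ F) = ringY q F := by
  simp [ringDehom]

theorem ringDehom_X_two : ringDehom q (MvPolynomial.X 2 : MvPolynomial _ F) = 1 := by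
  simp [ringDehom]

theorem algebraMap_ringDehom (a : MvPolynomial (Fin 3) F) :
    algebraMap (CoordRing q F) (FunField q F) (ringDehom q a) = dehom q a := by
  rw [ringDehom, dehom, ← MvPolynomial.aeval_algebraMap_apply]
  congr 2
  ext i
  fin_cases i <;> simp [ringX, ringY, coordX, coordY]

theorem algHom_ringDehom {A : Type*} [CommRing A] [Algebra F A] (ψ : CoordRing q F →ₐ[F] A)
    (a : MvPolynomial (Fin 3) F) :
    ψ (ringDehom q a) = aeval ![ψ (ringX q F), ψ (ringY q F), 1] a := by
  rw [ringDehom, ← AlgHom.comp_apply, MvPolynomial.comp_aeval]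
  congr 2
  ext i
  fin_cases i <;> simp

theorem ringDehom_surjective : Function.Surjective (ringDehom q (F := F)) := by
  intro r
  obtain ⟨p, rfl⟩ := AdjoinRoot.mk_surjective r
  refine ⟨p.eval₂ (Polynomial.aeval (MvPolynomial.X 1) : F[X] →ₐ[F] _).toRingHom
    (MvPolynomial.X 0), ?_⟩
  have hY : (ringDehom q).toRingHom.comp
      (Polynomial.aeval (MvPolynomial.X 1) : F[X] →ₐ[F] MvPolynomial (Fin 3) F).toRingHom =
        AdjoinRoot.of (affineEquation q F) := by
    ext c
    · change ringDehom q (Polynomial.aeval _ (Polynomial.C c)) = algebraMap F _ c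
      rw [Polynomial.aeval_C, AlgHom.commutes]
    · simpa [ringY] using ringDehom_X_one (q := q) (F := F)
  calc ringDehom q _ = p.eval₂ (AdjoinRoot.of _) (ringX q F) := by
        rw [← hY, ← ringDehom_X_zero]
        exact p.hom_eval₂ _ (ringDehom q).toRingHom _
    _ = AdjoinRoot.mk _ p := AdjoinRoot.aeval_eq p

/-- Multiplying the homogeneous components of a preimage by powers of `X₃` changes their degree
but not the function they define. -/
theorem exists_isHomogeneous_ringDehom_eq (r : CoordRing q F) : ∃ D : ℕ, ∀ d ≥ D,
    ∃ a : MvPolynomial (Fin 3) F, a.IsHomogeneous d ∧ ringDehom q a = r := by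
  obtain ⟨p, rfl⟩ := ringDehom_surjective r
  refine ⟨p.totalDegree, fun d hd => ⟨∑ i ∈ Finset.range (p.totalDegree + 1),
    MvPolynomial.homogeneousComponent i p * MvPolynomial.X 2 ^ (d - i),
    MvPolynomial.IsHomogeneous.sum _ _ _ fun i hi => ?_, ?_⟩⟩
  · have hid : i ≤ d := (Finset.mem_range_succ_iff.1 hi).trans hd
    simpa only [one_mul, Nat.add_sub_cancel' hid] using
      (MvPolynomial.homogeneousComponent_isHomogeneous i p).mul
        ((MvPolynomial.isHomogeneous_X F (2 : Fin 3)).pow (d - i))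
  · simp only [map_sum, map_mul, map_pow, ringDehom_X_two, one_pow, mul_one]
    rw [← map_sum, MvPolynomial.sum_homogeneousComponent]

theorem exists_isHomogeneous_ringDehom_eq_and_eq (r s : CoordRing q F) :
    ∃ (d : ℕ) (a b : MvPolynomial (Fin 3) F), a.IsHomogeneous d ∧ b.IsHomogeneous d ∧
      ringDehom q a = r ∧ ringDehom q b = s := by
  obtain ⟨D, hD⟩ := exists_isHomogeneous_ringDehom_eq r
  obtain ⟨E, hE⟩ := exists_isHomogeneous_ringDehom_eq s
  obtain ⟨a, ha, har⟩ := hD (max D E) (le_max_left _ _)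
  obtain ⟨b, hb, hbs⟩ := hE (max D E) (le_max_right _ _)
  exact ⟨_, a, b, ha, hb, har, hbs⟩

/-- The point of the curve with affine coordinates `(ψ x, ψ y)`, where `ψ` is a homomorphism from
the coordinate ring to the algebraic closure; these are all points except `(0 : 1 : 0)`. -/
noncomputable def pointOf (ψ : CoordRing q F →ₐ[F] AlgebraicClosure F) : Point q F :=
  ⟨Projectivization.mk _ ![ψ (ringX q F), ψ (ringY q F), 1]
    fun h => one_ne_zero (congrFun h 2), by
    have h := congrArg ψ (ringX_pow q F)
    simp only [map_add, map_pow] at h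
    rw [vanishes_mk_iff (isHomogeneous_hermitianForm q F), hermitianForm]
    simp [h]⟩

theorem vanishes_pointOf_iff (ψ : CoordRing q F →ₐ[F] AlgebraicClosure F)
    {a : MvPolynomial (Fin 3) F} {d : ℕ} (ha : a.IsHomogeneous d) :
    Vanishes a (pointOf ψ).1 ↔ ψ (ringDehom q a) = 0 := by
  rw [algHom_ringDehom, pointOf, vanishes_mk_iff ha]

theorem mem_localRing_pointOf_iff (ψ : CoordRing q F →ₐ[F] AlgebraicClosure F)
    (f : FunField q F) : f ∈ localRing (pointOf ψ) ↔ ∃ r s : CoordRing q F, ψ s ≠ 0 ∧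
      f * algebraMap _ _ s = algebraMap _ _ r := by
  constructor
  · rintro ⟨d, a, b, _, hb, hbP, h⟩
    refine ⟨ringDehom q a, ringDehom q b, (vanishes_pointOf_iff ψ hb).not.1 hbP, ?_⟩
    rw [algebraMap_ringDehom, algebraMap_ringDehom, h]
  · rintro ⟨r, s, hs, h⟩
    obtain ⟨d, a, b, ha, hb, rfl, rfl⟩ := exists_isHomogeneous_ringDehom_eq_and_eq r s
    refine ⟨d, a, b, ha, hb, (vanishes_pointOf_iff ψ hb).not.2 hs, ?_⟩
    rw [← algebraMap_ringDehom, ← algebraMap_ringDehom, h]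

theorem mem_maxIdeal_pointOf_iff (ψ : CoordRing q F →ₐ[F] AlgebraicClosure F)
    (f : FunField q F) : f ∈ maxIdeal (pointOf ψ) ↔ ∃ r s : CoordRing q F, ψ s ≠ 0 ∧ ψ r = 0 ∧
      f * algebraMap _ _ s = algebraMap _ _ r := by
  constructor
  · rintro ⟨d, a, b, ha, hb, hbP, haP, h⟩
    refine ⟨ringDehom q a, ringDehom q b, (vanishes_pointOf_iff ψ hb).not.1 hbP,
      (vanishes_pointOf_iff ψ ha).1 haP, ?_⟩
    rw [algebraMap_ringDehom, algebraMap_ringDehom, h]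
  · rintro ⟨r, s, hs, hr, h⟩
    obtain ⟨d, a, b, ha, hb, rfl, rfl⟩ := exists_isHomogeneous_ringDehom_eq_and_eq r s
    refine ⟨d, a, b, ha, hb, (vanishes_pointOf_iff ψ hb).not.2 hs,
      (vanishes_pointOf_iff ψ ha).2 hr, ?_⟩
    rw [← algebraMap_ringDehom, ← algebraMap_ringDehom, h]

theorem algebraMap_mem_localRing (ψ : CoordRing q F →ₐ[F] AlgebraicClosure F)
    (r : CoordRing q F) : algebraMap _ (FunField q F) r ∈ localRing (pointOf ψ) :=
  (mem_localRing_pointOf_iff ψ _).2 ⟨r, 1, by simp, by simp⟩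

/-- Evaluation of functions at an affine point of the curve over an extension of `F`. -/
noncomputable def evalHom {K : Type*} [Field K] [Algebra F K] (a b : K)
    (h : b ^ q + b = a ^ (q + 1)) : CoordRing q F →ₐ[F] K :=
  AdjoinRoot.liftAlgHom _ (Polynomial.aeval b) a (by
    simp only [affineEquation, Polynomial.eval₂_sub, Polynomial.eval₂_X_pow, Polynomial.eval₂_C]
    simp [h])

theorem evalHom_ringX {K : Type*} [Field K] [Algebra F K] {a b : K}
    (h : b ^ q + b = a ^ (q + 1)) : evalHom a b h (ringX q F) = a := by
  simp [evalHom, ringX]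

theorem evalHom_ringY {K : Type*} [Field K] [Algebra F K] {a b : K}
    (h : b ^ q + b = a ^ (q + 1)) : evalHom a b h (ringY q F) = b := by
  simp [evalHom, ringY]

section AffinePoint

variable {a b : F} (h : b ^ q + b = a ^ (q + 1))

theorem evalHom_ringDehom (V : MvPolynomial (Fin 3) F) :
    evalHom a b h (ringDehom q V) = eval ![a, b, 1] V := by
  rw [algHom_ringDehom, evalHom_ringX, evalHom_ringY]
  rfl

theorem affinePoint_eq_pointOf :
    affinePoint q a b h = pointOf ((Algebra.ofId F (AlgebraicClosure F)).comp (evalHom a b h)) := by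
  apply Subtype.ext
  simp only [affinePoint, affineProj, pointOf, AlgHom.comp_apply, evalHom_ringX, evalHom_ringY]
  rfl

theorem vanishes_affinePoint_iff {V : MvPolynomial (Fin 3) F} {d : ℕ} (hV : V.IsHomogeneous d) :
    Vanishes V (affinePoint q a b h).1 ↔ eval ![a, b, 1] V = 0 := by
  rw [affinePoint_eq_pointOf, vanishes_pointOf_iff _ hV, ← evalHom_ringDehom h]
  simp [Algebra.ofId_apply]

theorem mem_localRing_affinePoint_iff (f : FunField q F) :
    f ∈ localRing (affinePoint q a b h) ↔ ∃ r s : CoordRing q F, evalHom a b h s ≠ 0 ∧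
      f * algebraMap _ _ s = algebraMap _ _ r := by
  rw [affinePoint_eq_pointOf, mem_localRing_pointOf_iff]
  simp [Algebra.ofId_apply]

theorem mem_maxIdeal_affinePoint_iff (f : FunField q F) :
    f ∈ maxIdeal (affinePoint q a b h) ↔ ∃ r s : CoordRing q F, evalHom a b h s ≠ 0 ∧
      evalHom a b h r = 0 ∧ f * algebraMap _ _ s = algebraMap _ _ r := by
  rw [affinePoint_eq_pointOf, mem_maxIdeal_pointOf_iff]
  simp [Algebra.ofId_apply]

end AffinePoint

theorem affinePoint_inj {a b a' b' : F} {h : b ^ q + b = a ^ (q + 1)}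
    {h' : b' ^ q + b' = a' ^ (q + 1)} (hP : affinePoint q a b h = affinePoint q a' b' h') :
    a = a' ∧ b = b' := by
  obtain ⟨c, hc⟩ := Projectivization.mk_eq_mk_iff' .. |>.1 (congrArg Subtype.val hP)
  obtain rfl : c = 1 := by simpa using congrFun hc 2
  have h₀ := congrFun hc 0
  have h₁ := congrFun hc 1
  simp only [one_smul, Matrix.cons_val_zero, Matrix.cons_val_one] at h₀ h₁
  exact ⟨(algebraMap F _).injective h₀.symm, (algebraMap F _).injective h₁.symm⟩

/-- The point `(0 : 1 : 0)`, the only point of the curve at infinity. -/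
noncomputable def infPoint (q : ℕ) (hq : q ≠ 0) (F : Type*) [Field F] : Point q F :=
  ⟨Projectivization.mk _ ![0, 1, 0] fun h => one_ne_zero (congrFun h 1), by
    rw [vanishes_mk_iff (isHomogeneous_hermitianForm q F), hermitianForm]
    simp [hq]⟩

theorem pointOf_ne_infPoint (hq : q ≠ 0) (ψ : CoordRing q F →ₐ[F] AlgebraicClosure F) :
    pointOf ψ ≠ infPoint q hq F := by
  intro h
  obtain ⟨c, hc⟩ := Projectivization.mk_eq_mk_iff' .. |>.1 (congrArg Subtype.val h)
  simpa using congrFun hc 2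

theorem eq_infPoint_or_exists_eq_pointOf (hq : q ≠ 0) (P : Point q F) :
    P = infPoint q hq F ∨ ∃ ψ : CoordRing q F →ₐ[F] AlgebraicClosure F, P = pointOf ψ := by
  obtain ⟨P, hP⟩ := P
  have h : aeval P.rep (hermitianForm q F) = 0 := hP
  simp only [hermitianForm, map_sub, map_add, map_mul, map_pow, MvPolynomial.aeval_X] at h
  by_cases h₂ : P.rep 2 = 0
  · have h₀ : P.rep 0 = 0 := by
      rw [h₂] at h
      simpa [hq] using h
    refine .inl (Subtype.ext (P.mk_rep.symm.trans ?_))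
    refine (Projectivization.mk_eq_mk_iff' ..).2 ⟨P.rep 1, ?_⟩
    ext i
    fin_cases i <;> simp [h₀, h₂]
  · refine .inr ⟨evalHom (P.rep 0 / P.rep 2) (P.rep 1 / P.rep 2) ?_, ?_⟩
    · rw [div_pow, div_pow]
      field_simp
      linear_combination P.rep 2 * P.rep 2 ^ q * h
    · refine Subtype.ext (P.mk_rep.symm.trans ?_)
      simp only [pointOf, evalHom_ringX, evalHom_ringY]
      refine (Projectivization.mk_eq_mk_iff' ..).2 ⟨P.rep 2, ?_⟩
      ext i
      fin_cases i <;> simp <;> field_simp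

/-! ### Functions that are regular at all affine points -/

theorem isDomain_coordRing (hq : 2 ≤ q) (F : Type*) [Field F] : IsDomain (CoordRing q F) :=
  AdjoinRoot.isDomain_of_prime (affineEquation_irreducible hq F).prime

theorem exists_algHom_ker_eq (M : Ideal (CoordRing q F)) [M.IsMaximal] :
    ∃ ψ : CoordRing q F →ₐ[F] AlgebraicClosure F, RingHom.ker ψ = M := by
  let _ := Ideal.Quotient.field M
  have : Algebra.FiniteType F (CoordRing q F) :=
    .of_surjective (ringDehom q (F := F)) ringDehom_surjective
  have : Algebra.FiniteType F (CoordRing q F ⧸ M) :=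
    .of_surjective (Ideal.Quotient.mkₐ F M) (Ideal.Quotient.mkₐ_surjective F M)
  have : Module.Finite F (CoordRing q F ⧸ M) := finite_of_finite_type_of_isJacobsonRing _ _
  refine ⟨(IsAlgClosed.lift (M := AlgebraicClosure F) (R := F) (S := CoordRing q F ⧸ M)).comp
    (Ideal.Quotient.mkₐ F M), ?_⟩
  ext r
  simp [RingHom.mem_ker, Ideal.Quotient.eq_zero_iff_mem]

theorem mem_range_algebraMap_of_forall_mem_localRing (hq : 2 ≤ q) {f : FunField q F}
    (hf : ∀ ψ : CoordRing q F →ₐ[F] AlgebraicClosure F, f ∈ localRing (pointOf ψ)) :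
    f ∈ Set.range (algebraMap (CoordRing q F) (FunField q F)) := by
  have := isDomain_coordRing hq F
  suffices h : f ∈ (⊥ : Subalgebra (CoordRing q F) (FunField q F)) from Algebra.mem_bot.1 h
  rw [← MaximalSpectrum.iInf_localization_eq_bot, Algebra.mem_iInf]
  intro M
  obtain ⟨ψ, hψ⟩ := exists_algHom_ker_eq M.asIdeal
  obtain ⟨r, s, hs, h⟩ := (mem_localRing_pointOf_iff ψ f).1 (hf ψ)
  have hs₀ : algebraMap (CoordRing q F) (FunField q F) s ≠ 0 := by
    rw [Ne, FaithfulSMul.algebraMap_eq_zero_iff]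
    rintro rfl
    exact hs (map_zero ψ)
  refine ⟨r, s, fun hM : s ∈ M.asIdeal => hs ?_, (eq_mul_inv_iff_mul_eq₀ hs₀).2 h⟩
  rwa [← hψ, RingHom.mem_ker] at hM

end Points

/-! ### Normal forms and the filtration by the pole order at infinity -/

section NormalForm

variable {q : ℕ} {F : Type*} [Field F]

theorem monic_affineEquation (q : ℕ) (F : Type*) [Field F] : (affineEquation q F).Monic :=
  Polynomial.monic_X_pow_sub_C _ (Nat.succ_ne_zero q)

theorem degree_affineEquation (q : ℕ) (F : Type*) [Field F] :
    (affineEquation q F).degree = (q + 1 : ℕ) :=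
  Polynomial.degree_X_pow_sub_C (Nat.succ_pos q) _

/-- The representative of degree at most `q` in `x` of an element of the coordinate ring. -/
noncomputable def normalForm (r : CoordRing q F) : F[X][X] :=
  AdjoinRoot.modByMonicHom (monic_affineEquation q F) r

theorem mk_normalForm (r : CoordRing q F) :
    AdjoinRoot.mk (affineEquation q F) (normalForm r) = r :=
  AdjoinRoot.mk_leftInverse (monic_affineEquation q F) r

theorem degree_normalForm_lt (r : CoordRing q F) : (normalForm r).degree < (q + 1 : ℕ) := by
  obtain ⟨p, rfl⟩ := AdjoinRoot.mk_surjective r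
  rw [normalForm, AdjoinRoot.modByMonicHom_mk, ← degree_affineEquation q F]
  exact Polynomial.degree_modByMonic_lt p (monic_affineEquation q F)

theorem normalForm_mk {p : F[X][X]} (hp : p.degree < (q + 1 : ℕ)) :
    normalForm (AdjoinRoot.mk (affineEquation q F) p) = p := by
  rwa [normalForm, AdjoinRoot.modByMonicHom_mk,
    Polynomial.modByMonic_eq_self_iff (monic_affineEquation q F), degree_affineEquation]

/-- The coefficient of `x^i y^j`, `i ≤ q`, in the normal form. -/
noncomputable def coef (i j : ℕ) : CoordRing q F →ₗ[F] F :=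
  (Polynomial.lcoeff F j).comp (((Polynomial.lcoeff F[X] i).comp
    (AdjoinRoot.modByMonicHom (monic_affineEquation q F))).restrictScalars F)

theorem coef_apply (i j : ℕ) (r : CoordRing q F) :
    coef i j r = ((normalForm r).coeff i).coeff j := rfl

theorem mk_C_mul_X_pow (p : F[X]) (i : ℕ) :
    AdjoinRoot.mk (affineEquation q F) (Polynomial.C p * Polynomial.X ^ i) =
      Polynomial.aeval (ringY q F) p * ringX q F ^ i := by
  have hY : Polynomial.aeval (ringY q F) p = AdjoinRoot.of (affineEquation q F) p := by
    refine (Polynomial.aeval_algebraMap_apply (A := F[X]) (CoordRing q F) Polynomial.X p).trans ?_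
    rw [Polynomial.aeval_X_left_apply]
    rfl
  rw [map_mul, AdjoinRoot.mk_C, map_pow, AdjoinRoot.mk_X, hY]
  rfl

theorem normalForm_monomial {i : ℕ} (hi : i ≤ q) (j : ℕ) :
    normalForm (ringX q F ^ i * ringY q F ^ j) =
      Polynomial.C (Polynomial.X ^ j) * Polynomial.X ^ i := by
  rw [← normalForm_mk (q := q) (p := Polynomial.C (Polynomial.X ^ j) * Polynomial.X ^ i),
    mk_C_mul_X_pow, map_pow, Polynomial.aeval_X, mul_comm]
  exact (Polynomial.degree_C_mul_X_pow_le _ _).trans_lt (by exact_mod_cast Nat.lt_succ_of_le hi)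

theorem coef_monomial {i : ℕ} (hi : i ≤ q) (j i' j' : ℕ) :
    coef i' j' (ringX q F ^ i * ringY q F ^ j) = if i' = i ∧ j' = j then 1 else 0 := by
  rw [coef_apply, normalForm_monomial hi, Polynomial.coeff_C_mul, Polynomial.coeff_X_pow]
  by_cases h : i' = i <;> simp [h, Polynomial.coeff_X_pow]

theorem eq_sum_coef (r : CoordRing q F) : r = ∑ i ∈ (normalForm r).support,
    ∑ j ∈ ((normalForm r).coeff i).support, coef i j r • (ringX q F ^ i * ringY q F ^ j) := by
  conv_lhs => rw [← mk_normalForm r, (normalForm r).as_sum_support_C_mul_X_pow, map_sum]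
  refine Finset.sum_congr rfl fun i _ => ?_
  rw [mk_C_mul_X_pow, Polynomial.aeval_def, Polynomial.eval₂_eq_sum, Polynomial.sum,
    Finset.sum_mul]
  refine Finset.sum_congr rfl fun j _ => ?_
  rw [coef_apply, Algebra.smul_def]
  ring

theorem coef_mul_ringY_pow (i j d : ℕ) (r : CoordRing q F) :
    coef i (j + d) (r * ringY q F ^ d) = coef i j r := by
  have h : r * ringY q F ^ d = AdjoinRoot.mk (affineEquation q F)
      (Polynomial.C (Polynomial.X ^ d) * normalForm r) := by
    rw [map_mul, mk_normalForm, AdjoinRoot.mk_C, map_pow, mul_comm]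
    rfl
  have hdeg : (Polynomial.C (Polynomial.X ^ d) * normalForm r).degree <
      ((q + 1 : ℕ) : WithBot ℕ) := by
    rw [← Polynomial.smul_eq_C_mul]
    exact (Polynomial.degree_smul_le _ _).trans_lt (degree_normalForm_lt r)
  rw [h, coef_apply, normalForm_mk hdeg, coef_apply, Polynomial.coeff_C_mul,
    Polynomial.coeff_X_pow_mul]

/-- Reducing by `x^(q+1) = y^q + y` never raises the weight `q i + (q + 1) j` of `x^i y^j`, which is
the pole order of this monomial at `(0 : 1 : 0)`. -/
theorem weight_le_of_coef_ne_zero (hq : 1 ≤ q) {i j i' j' : ℕ}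
    (h : coef i' j' (ringX q F ^ i * ringY q F ^ j) ≠ 0) :
    q * i' + (q + 1) * j' ≤ q * i + (q + 1) * j := by
  induction i using Nat.strong_induction_on generalizing j with
  | _ i ih =>
    rcases le_or_gt i q with hi | hi
    · rw [coef_monomial hi] at h
      obtain ⟨⟨rfl, rfl⟩, -⟩ := ite_ne_right_iff.1 h
      rfl
    · obtain ⟨k, rfl⟩ := Nat.exists_eq_add_of_lt hi
      have hreduce : ringX q F ^ (q + k + 1) * ringY q F ^ j =
          ringX q F ^ k * ringY q F ^ (j + q) + ringX q F ^ k * ringY q F ^ (j + 1) := by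
        rw [show q + k + 1 = k + (q + 1) by ring, pow_add, ringX_pow]
        ring
      have h' : coef i' j' (ringX q F ^ k * ringY q F ^ (j + q)) ≠ 0 ∨
          coef i' j' (ringX q F ^ k * ringY q F ^ (j + 1)) ≠ 0 := by
        by_contra! hc
        exact h (by rw [hreduce, map_add, hc.1, hc.2, add_zero])
      rcases h' with h' | h'
      · exact (ih k (by omega) h').trans_eq (by ring)
      · exact (ih k (by omega) h').trans (by nlinarith)

/-- The span of the monomials `x^i y^j` of weight `q i + (q + 1) j` less than `n`: the functions in
the coordinate ring with a pole of order less than `n` at `(0 : 1 : 0)`. -/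
noncomputable def weightLT (q : ℕ) (F : Type*) [Field F] (n : ℕ) : Submodule F (CoordRing q F) :=
  Submodule.span F {r | ∃ i j : ℕ, q * i + (q + 1) * j < n ∧ ringX q F ^ i * ringY q F ^ j = r}

theorem monomial_mem_weightLT {i j n : ℕ} (h : q * i + (q + 1) * j < n) :
    ringX q F ^ i * ringY q F ^ j ∈ weightLT q F n :=
  Submodule.subset_span ⟨i, j, h, rfl⟩

theorem weightLT_mono {m n : ℕ} (h : m ≤ n) : weightLT q F m ≤ weightLT q F n :=
  Submodule.span_mono fun _ ⟨i, j, hij, hr⟩ => ⟨i, j, hij.trans_le h, hr⟩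

theorem mul_mem_weightLT {m n : ℕ} {r s : CoordRing q F} (hr : r ∈ weightLT q F (m + 1))
    (hs : s ∈ weightLT q F n) : r * s ∈ weightLT q F (m + n) := by
  have h := Submodule.mul_mem_mul hr hs
  rw [weightLT, weightLT, Submodule.span_mul_span] at h
  refine Submodule.span_mono ?_ h
  rintro _ ⟨_, ⟨i, j, hij, rfl⟩, _, ⟨i', j', hij', rfl⟩, rfl⟩
  exact ⟨i + i', j + j', by nlinarith, by simp only [pow_add]; ring⟩

theorem mem_weightLT_iff (hq : 1 ≤ q) {n : ℕ} {r : CoordRing q F} : r ∈ weightLT q F n ↔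
    ∀ i j : ℕ, n ≤ q * i + (q + 1) * j → coef i j r = 0 := by
  constructor
  · intro h i j hij
    induction h using Submodule.span_induction with
    | mem r hr =>
      obtain ⟨i', j', hlt, rfl⟩ := hr
      by_contra hc
      have := weight_le_of_coef_ne_zero hq hc
      omega
    | zero => exact map_zero _
    | add r s _ _ hr hs => rw [map_add, hr, hs, add_zero]
    | smul c r _ hr => rw [map_smul, hr, smul_zero]
  · intro h
    rw [eq_sum_coef r]
    refine Submodule.sum_mem _ fun i _ => Submodule.sum_mem _ fun j _ => ?_
    rcases lt_or_ge (q * i + (q + 1) * j) n with hij | hij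
    · exact Submodule.smul_mem _ _ (monomial_mem_weightLT hij)
    · rw [h i j hij, zero_smul]
      exact Submodule.zero_mem _

theorem exists_mem_weightLT (r : CoordRing q F) : ∃ n, r ∈ weightLT q F n := by
  have hmono : Monotone (weightLT q F) := fun _ _ => weightLT_mono
  have hmem : r ∈ ⨆ n, weightLT q F n := by
    rw [eq_sum_coef r]
    exact Submodule.sum_mem _ fun i _ => Submodule.sum_mem _ fun j _ => Submodule.smul_mem _ _ <|
      Submodule.mem_iSup_of_mem _ (monomial_mem_weightLT (lt_add_one _))
  exact (Submodule.mem_iSup_of_directed _ hmono.directed_le).1 hmem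

/-- If `s` has leading term `c y^d`, then multiplication by `s` raises weights by `(q + 1) d`. -/
theorem mem_weightLT_of_mul_mem (hq : 1 ≤ q) {d n : ℕ} {c : F} (hc : c ≠ 0)
    {r s : CoordRing q F} (hs : s - c • ringY q F ^ d ∈ weightLT q F ((q + 1) * d))
    (hrs : r * s ∈ weightLT q F (n + (q + 1) * d)) : r ∈ weightLT q F n := by
  obtain ⟨k, hk⟩ := exists_mem_weightLT r
  replace hk : r ∈ weightLT q F (n + k) := weightLT_mono (by omega) hk
  induction k with
  | zero => exact hk
  | succ k ih =>
    refine ih ((mem_weightLT_iff hq).2 fun i j hij => ?_)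
    have hlead : c • (r * ringY q F ^ d) ∈ weightLT q F (n + k + (q + 1) * d) := by
      have := Submodule.sub_mem _ (weightLT_mono (by omega) hrs)
        (mul_mem_weightLT (m := n + k) hk hs)
      rwa [mul_sub, sub_sub_cancel, mul_smul_comm] at this
    have hcoef := (mem_weightLT_iff hq).1 hlead i (j + d) (by nlinarith)
    rw [map_smul, coef_mul_ringY_pow, smul_eq_mul] at hcoef
    exact (mul_eq_zero.1 hcoef).resolve_left hc

theorem ringDehom_eq_sum (a : MvPolynomial (Fin 3) F) : ringDehom q a =
    ∑ m ∈ a.support, a.coeff m • (ringX q F ^ m 0 * ringY q F ^ m 1) := by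
  rw [ringDehom, MvPolynomial.aeval_def, MvPolynomial.eval₂_eq']
  refine Finset.sum_congr rfl fun m _ => ?_
  simp [Fin.prod_univ_three, Algebra.smul_def]

theorem add_add_eq_of_isHomogeneous {R : Type*} [CommSemiring R] {a : MvPolynomial (Fin 3) R}
    {d : ℕ} (ha : a.IsHomogeneous d) {m : Fin 3 →₀ ℕ} (hm : m ∈ a.support) :
    m 0 + m 1 + m 2 = d := by
  have hd : m.degree = d := by
    rw [Finsupp.degree_eq_weight_one]
    exact ha (MvPolynomial.mem_support_iff.1 hm)
  rwa [Finsupp.degree_eq_sum, Fin.sum_univ_three] at hd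

theorem ringDehom_mem_weightLT {a : MvPolynomial (Fin 3) F} {d : ℕ} (ha : a.IsHomogeneous d) :
    ringDehom q a ∈ weightLT q F ((q + 1) * d + 1) := by
  rw [ringDehom_eq_sum]
  refine Submodule.sum_mem _ fun m hm => Submodule.smul_mem _ _ (monomial_mem_weightLT ?_)
  rw [← add_add_eq_of_isHomogeneous ha hm]
  nlinarith [mul_nonneg (Nat.zero_le q) (Nat.zero_le (m 2))]

theorem ringDehom_sub_mem_weightLT {a : MvPolynomial (Fin 3) F} {d : ℕ} (ha : a.IsHomogeneous d) :
    ringDehom q a - MvPolynomial.eval ![0, 1, 0] a • ringY q F ^ d ∈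
      weightLT q F ((q + 1) * d) := by
  rw [ringDehom_eq_sum, MvPolynomial.eval_eq', Finset.sum_smul, ← Finset.sum_sub_distrib]
  refine Submodule.sum_mem _ fun m hm => ?_
  have hd := add_add_eq_of_isHomogeneous ha hm
  simp only [Fin.prod_univ_three, Matrix.cons_val_zero, Matrix.cons_val_one, Matrix.cons_val]
  by_cases h : m 0 = 0 ∧ m 2 = 0
  · rw [h.1, h.2, show m 1 = d by omega]
    simp
  · have h₀ : (0 : F) ^ m 0 * 1 ^ m 1 * 0 ^ m 2 = 0 := by
      rcases not_and_or.1 h with h | h <;> rw [zero_pow h] <;> ring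
    rw [h₀, mul_zero, zero_smul, sub_zero]
    refine Submodule.smul_mem _ _ (monomial_mem_weightLT ?_)
    rw [← hd]
    nlinarith [mul_nonneg (Nat.zero_le q) (Nat.zero_le (m 2)), show 1 ≤ m 0 + m 2 by omega]

end NormalForm

/-! ### Orders at the affine rational points -/

section LocalParameter

variable {q : ℕ} {F : Type*} [Field F]

theorem algebraMap_coordRing_injective (q : ℕ) (F : Type*) [Field F] :
    Function.Injective (algebraMap (CoordRing q F) (FunField q F)) :=
  IsFractionRing.injective _ _

theorem mem_one_iff_mem_localRing {P : Point q F} {f : FunField q F} :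
    f ∈ (1 : Submodule (localRing P) (FunField q F)) ↔ f ∈ localRing P := by
  rw [Submodule.mem_one]
  exact ⟨fun ⟨y, hy⟩ => hy ▸ y.2, fun h => ⟨⟨f, h⟩, rfl⟩⟩

theorem mem_ordGE_zero_iff {P : Point q F} {f : FunField q F} :
    f ∈ ordGE P 0 ↔ f ∈ localRing P :=
  mem_one_iff_mem_localRing (P := P)

theorem mem_ordGE_neg_iff {P : Point q F} {n : ℕ} {f : FunField q F} :
    f ∈ ordGE P (-n) ↔ ∀ g ∈ maxIdeal P ^ n, f * g ∈ localRing P := by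
  cases n with
  | zero =>
    rw [Nat.cast_zero, neg_zero, mem_ordGE_zero_iff, pow_zero]
    exact ⟨fun hf g hg => mul_mem hf (mem_one_iff_mem_localRing.1 hg),
      fun hf => by simpa using hf 1 (mem_one_iff_mem_localRing.2 (one_mem _))⟩
  | succ n =>
    change f ∈ 1 / maxIdeal P ^ (n + 1) ↔ _
    simp only [Submodule.mem_div_iff_forall_mul_mem, mem_one_iff_mem_localRing]

theorem algebraMap_ringX : algebraMap (CoordRing q F) (FunField q F) (ringX q F) = coordX q F :=
  rfl

theorem algebraMap_ringX_sub (a : F) :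
    algebraMap (CoordRing q F) (FunField q F) (ringX q F - algebraMap F _ a) =
      coordX q F - algebraMap F _ a := by
  rw [map_sub, algebraMap_ringX, ← IsScalarTower.algebraMap_apply]

theorem coordX_sub_ne_zero (hq : 1 ≤ q) (a : F) : coordX q F - algebraMap F _ a ≠ 0 := by
  rw [← algebraMap_ringX_sub, Ne, FaithfulSMul.algebraMap_eq_zero_iff]
  have h := AdjoinRoot.mk_ne_zero_of_degree_lt (monic_affineEquation q F)
    (Polynomial.X_sub_C_ne_zero (Polynomial.C a))
    (by rw [Polynomial.degree_X_sub_C, degree_affineEquation]; exact_mod_cast Nat.lt_succ_of_le hq)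
  rwa [map_sub, AdjoinRoot.mk_X, AdjoinRoot.mk_C] at h

theorem ker_evalHom {a b : F} (h : b ^ q + b = a ^ (q + 1)) :
    RingHom.ker (evalHom a b h) =
      Ideal.span {ringX q F - algebraMap F _ a, ringY q F - algebraMap F _ b} := by
  set I := Ideal.span {ringX q F - algebraMap F _ a, ringY q F - algebraMap F _ b}
  refine le_antisymm (fun r hr => ?_) (Ideal.span_le.2 ?_)
  · obtain ⟨p, rfl⟩ := ringDehom_surjective r
    have hmk : (Ideal.Quotient.mkₐ F I).comp (ringDehom q) =
        ((Algebra.ofId F (CoordRing q F ⧸ I)).comp (evalHom a b h)).comp (ringDehom q) := by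
      have hX : Ideal.Quotient.mk I (ringX q F) = Ideal.Quotient.mk I (algebraMap F _ a) :=
        Ideal.Quotient.eq.2 (Ideal.subset_span (by simp))
      have hY : Ideal.Quotient.mk I (ringY q F) = Ideal.Quotient.mk I (algebraMap F _ b) :=
        Ideal.Quotient.eq.2 (Ideal.subset_span (by simp))
      refine MvPolynomial.algHom_ext fun i => ?_
      fin_cases i
      · simp [ringDehom_X_zero, evalHom_ringX, hX]
      · simp [ringDehom_X_one, evalHom_ringY, hY]
      · simp [ringDehom_X_two]
    refine Ideal.Quotient.eq_zero_iff_mem.1 ((DFunLike.congr_fun hmk p).trans ?_)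
    rw [AlgHom.comp_apply, AlgHom.comp_apply, (RingHom.mem_ker).1 hr, map_zero]
  · rintro _ (rfl | rfl)
    · simp [evalHom_ringX]
    · simp [evalHom_ringY]

variable [Fintype F] {a b : F}

/-- With `z = y - b`, the equation of the curve reads `z (z^(q-1) + 1) = x^(q+1) - a^(q+1)`, where
`z^(q-1) + 1` does not vanish at `(a : b : 1)`. -/
theorem exists_mul_eq_of_evalHom_eq_zero (hF : Fintype.card F = q ^ 2) (hq : 2 ≤ q)
    (h : b ^ q + b = a ^ (q + 1)) {r : CoordRing q F} (hr : evalHom a b h r = 0) :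
    ∃ s t : CoordRing q F, evalHom a b h s ≠ 0 ∧ r * s = t * (ringX q F - algebraMap F _ a) := by
  obtain ⟨c, d, rfl⟩ := Ideal.mem_span_pair.1 ((ker_evalHom h).le hr)
  set z := ringY q F - algebraMap F _ b with hz
  obtain ⟨k, hk⟩ := sub_dvd_pow_sub_pow (ringX q F) (algebraMap F _ a) (q + 1)
  have hzk : z * (z ^ (q - 1) + 1) = (ringX q F - algebraMap F _ a) * k := by
    have h' := congrArg (algebraMap F (CoordRing q F)) h
    simp only [map_add, map_pow] at h'
    rw [← hk, mul_add, ← pow_succ', Nat.sub_add_cancel (by omega), hz,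
      sub_pow_of_card_eq_pow two_ne_zero hF, ringX_pow, ← h']
    ring
  refine ⟨z ^ (q - 1) + 1, c * (z ^ (q - 1) + 1) + d * k, ?_, by linear_combination d * hzk⟩
  have hz₀ : evalHom a b h z = 0 := by simp [hz, evalHom_ringY]
  rw [map_add, map_pow, hz₀, zero_pow (by omega), zero_add, map_one]
  exact one_ne_zero

theorem maxIdeal_affinePoint (hF : Fintype.card F = q ^ 2) (hq : 2 ≤ q)
    (h : b ^ q + b = a ^ (q + 1)) : maxIdeal (affinePoint q a b h) =
      Submodule.span (localRing (affinePoint q a b h)) {coordX q F - algebraMap F _ a} := by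
  have := isDomain_coordRing hq F
  have hx := coordX_sub_ne_zero (show 1 ≤ q by omega) a
  refine le_antisymm (fun g hg => ?_) ?_
  · obtain ⟨r, s, hs, hr, hgs⟩ := (mem_maxIdeal_affinePoint_iff h g).1 hg
    obtain ⟨s', t, hs', hst⟩ := exists_mul_eq_of_evalHom_eq_zero hF hq h hr
    refine Submodule.mem_span_singleton.2 ⟨⟨g / (coordX q F - algebraMap F _ a), ?_⟩,
      div_mul_cancel₀ g hx⟩
    refine (mem_localRing_affinePoint_iff h _).2 ⟨t, s * s', ?_, ?_⟩
    · rw [map_mul]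
      exact mul_ne_zero hs hs'
    · rw [div_mul_eq_mul_div, div_eq_iff hx, map_mul, ← mul_assoc, hgs, ← algebraMap_ringX_sub,
        ← map_mul, ← map_mul, hst]
  · rw [Submodule.span_singleton_le_iff_mem, mem_maxIdeal_affinePoint_iff]
    exact ⟨ringX q F - algebraMap F _ a, 1, by simp, by simp [evalHom_ringX],
      by rw [algebraMap_ringX_sub, map_one, mul_one]⟩

theorem mem_ordGE_neg_affinePoint_iff (hF : Fintype.card F = q ^ 2) (hq : 2 ≤ q)
    (h : b ^ q + b = a ^ (q + 1)) {n : ℕ} {f : FunField q F} :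
    f ∈ ordGE (affinePoint q a b h) (-n) ↔
      f * (coordX q F - algebraMap F _ a) ^ n ∈ localRing (affinePoint q a b h) := by
  rw [mem_ordGE_neg_iff, maxIdeal_affinePoint hF hq h, Submodule.span_pow, Set.singleton_pow]
  refine ⟨fun hf => hf _ (Submodule.mem_span_singleton_self _), fun hf g hg => ?_⟩
  obtain ⟨⟨t, ht⟩, rfl⟩ := Submodule.mem_span_singleton.1 hg
  rw [Subalgebra.smul_def, smul_eq_mul, mul_left_comm]
  exact mul_mem ht hf

end LocalParameter

/-! ### The Riemann–Roch space -/

section RiemannRoch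

variable {q m : ℕ} {F : Type*} [Field F]

/-- The forms `X₂ X₃ g + ε X₁^m` with `g` homogeneous of degree `m - 2`: the linear system together
with the zero form. -/
noncomputable def formSpace (F : Type*) [Field F] (m : ℕ) : Submodule F (MvPolynomial (Fin 3) F) :=
  (MvPolynomial.homogeneousSubmodule (Fin 3) F (m - 2)).map
      (LinearMap.mulLeft F (MvPolynomial.X 1 * MvPolynomial.X 2)) ⊔
    Submodule.span F {MvPolynomial.X 0 ^ m}

theorem mem_formSpace_iff {V : MvPolynomial (Fin 3) F} : V ∈ formSpace F m ↔
    ∃ (g : MvPolynomial (Fin 3) F) (ε : F), g.IsHomogeneous (m - 2) ∧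
      V = MvPolynomial.X 1 * MvPolynomial.X 2 * g + MvPolynomial.C ε * MvPolynomial.X 0 ^ m := by
  simp only [formSpace, Submodule.mem_sup, Submodule.mem_map, Submodule.mem_span_singleton,
    MvPolynomial.mem_homogeneousSubmodule, LinearMap.mulLeft_apply, MvPolynomial.smul_eq_C_mul]
  aesop

theorem mem_linearSystem_iff {V : MvPolynomial (Fin 3) F} :
    V ∈ linearSystem F m ↔ V ≠ 0 ∧ V ∈ formSpace F m := by
  rw [mem_formSpace_iff]
  rfl

theorem isHomogeneous_of_mem_formSpace (hm : 2 ≤ m) {V : MvPolynomial (Fin 3) F}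
    (hV : V ∈ formSpace F m) : V.IsHomogeneous m := by
  obtain ⟨g, ε, hg, rfl⟩ := mem_formSpace_iff.1 hV
  have hX := MvPolynomial.isHomogeneous_X (σ := Fin 3) F
  refine .add ?_ ?_
  · simpa [show 1 + 1 + (m - 2) = m by omega] using ((hX 1).mul (hX 2)).mul hg
  · simpa using (MvPolynomial.isHomogeneous_C (Fin 3) ε).mul ((hX 0).pow m)

theorem exists_mem_formSpace_ringDehom_eq (hq : 1 ≤ q) {r : CoordRing q F}
    (hr₀ : ∀ i < m, coef i 0 r = 0) (hr : r ∈ weightLT q F (m * q + 1)) :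
    ∃ V ∈ formSpace F m, ringDehom q V = r := by
  suffices h : r ∈ (formSpace F m).map (ringDehom q).toLinearMap from h
  rw [eq_sum_coef r]
  refine Submodule.sum_mem _ fun i _ => Submodule.sum_mem _ fun j _ => ?_
  by_cases hij : coef i j r = 0
  · rw [hij, zero_smul]
    exact Submodule.zero_mem _
  refine Submodule.smul_mem _ _ ?_
  have hweight : q * (i + j) + j ≤ m * q := by
    by_contra! h
    exact hij ((mem_weightLT_iff hq).1 hr i j (by linarith))
  obtain rfl | hj := Nat.eq_zero_or_pos j
  · have hi : i = m :=
      le_antisymm (by nlinarith) (not_lt.1 fun hi => hij (hr₀ i hi))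
    refine ⟨MvPolynomial.X 0 ^ m, mem_formSpace_iff.2
      ⟨0, 1, MvPolynomial.isHomogeneous_zero _ _ _, by simp⟩, ?_⟩
    simp [ringDehom_X_zero, hi]
  · have hlt : i + j < m := by nlinarith
    obtain ⟨k, rfl⟩ := Nat.exists_eq_add_of_lt hlt
    obtain ⟨j, rfl⟩ := Nat.exists_eq_add_of_le' hj
    have hX := MvPolynomial.isHomogeneous_X (σ := Fin 3) F
    refine ⟨_, mem_formSpace_iff.2 ⟨MvPolynomial.X 0 ^ i * MvPolynomial.X 1 ^ j *
      MvPolynomial.X 2 ^ k, 0, ?_, rfl⟩, ?_⟩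
    · convert (((hX 0).pow i).mul ((hX 1).pow j)).mul ((hX 2).pow k) using 1
      omega
    · simp only [AlgHom.toLinearMap_apply, map_add, map_mul, map_pow, map_zero, ringDehom_X_zero,
        ringDehom_X_one, ringDehom_X_two]
      ring

/-- The restriction of the curve to the line `y = 0` is given by `x^(q+1) = 0`. -/
theorem coef_eq_zero_of_mul_eq (hm : m ≤ q + 1) (hq : q ≠ 0) {r s t : CoordRing q F}
    (hs : coef 0 0 s ≠ 0) (h : r * s = ringX q F ^ m * t) {i : ℕ} (hi : i < m) :
    coef i 0 r = 0 := by
  let φ : F[X][X] →+* F[X] := Polynomial.mapRingHom (Polynomial.evalRingHom 0)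
  have hφ (k : ℕ) (z : CoordRing q F) : (φ (normalForm z)).coeff k = coef k 0 z := by
    simp [φ, coef_apply, Polynomial.coeff_zero_eq_eval_zero]
  have hdvd : affineEquation q F ∣
      normalForm r * normalForm s - Polynomial.X ^ m * normalForm t := by
    rw [← AdjoinRoot.mk_eq_zero, map_sub, map_mul, map_mul, map_pow, AdjoinRoot.mk_X,
      mk_normalForm, mk_normalForm, mk_normalForm, h, ringX, sub_self]
  have hφdvd : Polynomial.X ^ (q + 1) ∣
      φ (normalForm r) * φ (normalForm s) - Polynomial.X ^ m * φ (normalForm t) := by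
    simpa [φ, affineEquation, hq] using map_dvd φ hdvd
  have hX : Polynomial.X ^ m ∣ φ (normalForm r) := by
    refine Polynomial.prime_X.pow_dvd_of_dvd_mul_right m (fun hX => hs ?_)
      ((dvd_sub_left (Dvd.intro _ rfl)).1 ((pow_dvd_pow _ hm).trans hφdvd))
    rw [← hφ, Polynomial.X_dvd_iff.1 hX]
  rw [← hφ]
  exact Polynomial.X_pow_dvd_iff.1 hX i hi

theorem evalHom_zero_zero (h : (0 : F) ^ q + 0 = 0 ^ (q + 1)) (s : CoordRing q F) :
    evalHom 0 0 h s = coef 0 0 s := by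
  conv_lhs => rw [← mk_normalForm s]
  rw [evalHom, AdjoinRoot.liftAlgHom_mk, coef_apply, Polynomial.eval₂_at_zero]
  simp [Polynomial.coeff_zero_eq_eval_zero]

theorem coef_eq_zero_of_mem_localRing (hm : m ≤ q + 1) (hq : q ≠ 0) {f : FunField q F}
    {r : CoordRing q F} (hr : f * coordX q F ^ m = algebraMap _ _ r)
    (h : (0 : F) ^ q + 0 = 0 ^ (q + 1)) (hf : f ∈ localRing (affinePoint q 0 0 h)) {i : ℕ}
    (hi : i < m) : coef i 0 r = 0 := by
  obtain ⟨t, s, hs, hst⟩ := (mem_localRing_affinePoint_iff h f).1 hf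
  rw [evalHom_zero_zero] at hs
  refine coef_eq_zero_of_mul_eq hm hq hs (algebraMap_coordRing_injective q F ?_) hi (t := t)
  rw [map_mul, map_mul, map_pow, ← hr, ← hst, algebraMap_ringX]
  ring

theorem vanishes_infPoint_iff (hq : q ≠ 0) {V : MvPolynomial (Fin 3) F} {d : ℕ}
    (hV : V.IsHomogeneous d) :
    Vanishes V (infPoint q hq F).1 ↔ MvPolynomial.eval ![0, 1, 0] V = 0 := by
  have hvec : (![0, 1, 0] : Fin 3 → AlgebraicClosure F) = algebraMap F _ ∘ ![0, 1, 0] := by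
    ext i
    fin_cases i <;> simp
  rw [infPoint, vanishes_mk_iff hV, hvec, MvPolynomial.aeval_algebraMap_apply,
    FaithfulSMul.algebraMap_eq_zero_iff]
  rfl

theorem mem_weightLT_of_mem_localRing (hq : q ≠ 0) {f : FunField q F} {r : CoordRing q F}
    (hr : f * coordX q F ^ m = algebraMap _ _ r) (hf : f ∈ localRing (infPoint q hq F)) :
    r ∈ weightLT q F (m * q + 1) := by
  obtain ⟨d, a, b, ha, hb, hbP, h⟩ := hf
  rw [vanishes_infPoint_iff hq hb] at hbP
  refine mem_weightLT_of_mul_mem (by omega) hbP (ringDehom_sub_mem_weightLT hb) ?_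
  have hrb : r * ringDehom q b = (ringX q F ^ m * ringY q F ^ 0) * ringDehom q a := by
    apply algebraMap_coordRing_injective q F
    rw [pow_zero, mul_one, map_mul, map_mul, map_pow, ← hr, algebraMap_ringDehom,
      algebraMap_ringDehom, ← h, algebraMap_ringX]
    ring
  rw [hrb, show m * q + 1 + (q + 1) * d = m * q + ((q + 1) * d + 1) by ring]
  exact mul_mem_weightLT (monomial_mem_weightLT (by linarith)) (ringDehom_mem_weightLT ha)

variable [Fintype F] [DecidableEq F]

theorem divG_affinePoint (m : ℕ) {b : F} (h : b ^ q + b = 0 ^ (q + 1)) (hb : b ≠ 0) :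
    divG q F m (affinePoint q 0 b h) = m := by
  classical
  rw [divG, Finsupp.finsetSum_apply, Finset.sum_eq_single ⟨b, by simpa using h, hb⟩]
  · simp
  · intro b' _ hne
    rw [Finsupp.single_apply, if_neg]
    exact fun hP => hne (Subtype.ext (affinePoint_inj hP).2)
  · simp

theorem divG_of_ne (m : ℕ) {P : Point q F} (hP : ∀ (b : F) (h : b ^ q + b = 0 ^ (q + 1)),
    b ≠ 0 → P ≠ affinePoint q 0 b h) : divG q F m P = 0 := by
  classical
  rw [divG, Finsupp.finsetSum_apply]
  refine Finset.sum_eq_zero fun b _ => ?_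
  rw [Finsupp.single_apply, if_neg]
  exact fun h => hP _ _ b.2.2 h.symm

theorem mem_riemannRoch_divG_iff_forall (hF : Fintype.card F = q ^ 2) (hq : 2 ≤ q)
    {f : FunField q F} : f ∈ riemannRoch (divG q F m) ↔
      (∀ P : Point q F, (∀ (b : F) (h : b ^ q + b = 0 ^ (q + 1)), b ≠ 0 →
        P ≠ affinePoint q 0 b h) → f ∈ localRing P) ∧
      ∀ (b : F) (h : b ^ q + b = 0 ^ (q + 1)), b ≠ 0 →
        f * coordX q F ^ m ∈ localRing (affinePoint q 0 b h) := by
  have hG (b : F) (h : b ^ q + b = 0 ^ (q + 1)) (hb : b ≠ 0) :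
      f ∈ ordGE (affinePoint q 0 b h) (-(divG q F m (affinePoint q 0 b h))) ↔
        f * coordX q F ^ m ∈ localRing (affinePoint q 0 b h) := by
    rw [divG_affinePoint m h hb, mem_ordGE_neg_affinePoint_iff hF hq h, map_zero, sub_zero]
  have hG₀ (P : Point q F) (hP : ∀ (b : F) (h : b ^ q + b = 0 ^ (q + 1)), b ≠ 0 →
      P ≠ affinePoint q 0 b h) : f ∈ ordGE P (-(divG q F m P)) ↔ f ∈ localRing P := by
    rw [divG_of_ne m hP, neg_zero, mem_ordGE_zero_iff]
  simp only [riemannRoch, Submodule.mem_iInf, Submodule.restrictScalars_mem]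
  refine ⟨fun hf => ⟨fun P hP => (hG₀ P hP).1 (hf P), fun b h hb => (hG b h hb).1 (hf _)⟩,
    fun ⟨hf₀, hf⟩ P => ?_⟩
  by_cases hP : ∀ (b : F) (h : b ^ q + b = 0 ^ (q + 1)), b ≠ 0 → P ≠ affinePoint q 0 b h
  · exact (hG₀ P hP).2 (hf₀ P hP)
  · push Not at hP
    obtain ⟨b, h, hb, rfl⟩ := hP
    exact (hG b h hb).2 (hf b h hb)

theorem exists_mem_formSpace_of_mem_riemannRoch (hF : Fintype.card F = q ^ 2) (hq : 2 ≤ q)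
    (hm : m ≤ q + 1) {f : FunField q F} (hf : f ∈ riemannRoch (divG q F m)) :
    ∃ V ∈ formSpace F m, f * coordX q F ^ m = dehom q V := by
  obtain ⟨hf₀, hf⟩ := (mem_riemannRoch_divG_iff_forall hF hq).1 hf
  have hq₀ : q ≠ 0 := by omega
  have hreg (ψ : CoordRing q F →ₐ[F] AlgebraicClosure F) :
      f * coordX q F ^ m ∈ localRing (pointOf ψ) := by
    by_cases hP : ∀ (b : F) (h : b ^ q + b = 0 ^ (q + 1)), b ≠ 0 → pointOf ψ ≠ affinePoint q 0 b h
    · exact mul_mem (hf₀ _ hP) (pow_mem (algebraMap_mem_localRing ψ _) m)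
    · push Not at hP
      obtain ⟨b, h, hb, hP⟩ := hP
      exact hP ▸ hf b h hb
  obtain ⟨r, hr⟩ := mem_range_algebraMap_of_forall_mem_localRing hq hreg
  have h₀ : (0 : F) ^ q + 0 = 0 ^ (q + 1) := by simp [hq₀]
  have horigin : f ∈ localRing (affinePoint q 0 0 h₀) :=
    hf₀ _ fun b h hb hP => hb (affinePoint_inj hP).2.symm
  have hinf : f ∈ localRing (infPoint q hq₀ F) := hf₀ _ fun b h _ hP =>
    pointOf_ne_infPoint hq₀ _ ((affinePoint_eq_pointOf h).symm.trans hP.symm)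
  obtain ⟨V, hV, rfl⟩ := exists_mem_formSpace_ringDehom_eq (by omega)
    (fun i hi => coef_eq_zero_of_mem_localRing hm hq₀ hr.symm h₀ horigin hi)
    (mem_weightLT_of_mem_localRing hq₀ hr.symm hinf)
  exact ⟨V, hV, by rw [← hr, algebraMap_ringDehom]⟩

end RiemannRoch

section FormQuotients

variable {q m : ℕ} {F : Type*} [Field F]

theorem isHomogeneous_X_one_pow_add_X_two_pow (F : Type*) [Field F] (n : ℕ) :
    (MvPolynomial.X 1 ^ n + MvPolynomial.X 2 ^ n : MvPolynomial (Fin 3) F).IsHomogeneous n :=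
  (MvPolynomial.isHomogeneous_X_pow 1 n).add (MvPolynomial.isHomogeneous_X_pow 2 n)

theorem coordX_ne_zero (hq : 1 ≤ q) : coordX q F ≠ 0 := by
  simpa using coordX_sub_ne_zero hq (0 : F)

theorem coordX_pow (q : ℕ) (F : Type*) [Field F] :
    coordX q F ^ (q + 1) = coordY q F ^ q + coordY q F := by
  have h := congrArg (algebraMap _ (FunField q F)) (ringX_pow q F)
  rwa [map_pow, map_add, map_pow] at h

theorem mem_localRing_of_not_vanishes_X_zero {V : MvPolynomial (Fin 3) F} (hV : V.IsHomogeneous m)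
    {f : FunField q F} (hf : f * coordX q F ^ m = dehom q V) {P : Point q F}
    (hP : ¬Vanishes (MvPolynomial.X 0 : MvPolynomial (Fin 3) F) P.1) : f ∈ localRing P :=
  ⟨m, V, MvPolynomial.X 0 ^ m, hV, MvPolynomial.isHomogeneous_X_pow 0 m,
    fun h => hP (eq_zero_of_pow_eq_zero (by simpa only [Vanishes, map_pow] using h)),
    by simpa [dehom] using hf⟩

/-- Since `x^(q+1) = y (y^(q-1) + 1)`, the function `(y g + ε x^m) / x^m` is also equal to
`(g x^(q+1-m) + ε (y^(q-1) + 1)) / (y^(q-1) + 1)`. -/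
theorem mem_localRing_of_not_vanishes_X_pow_add (hq : 2 ≤ q) (hm : 2 ≤ m) (hmq : m ≤ q + 1)
    {V : MvPolynomial (Fin 3) F} (hV : V ∈ formSpace F m) {f : FunField q F}
    (hf : f * coordX q F ^ m = dehom q V) {P : Point q F}
    (hP : ¬Vanishes (MvPolynomial.X 1 ^ (q - 1) + MvPolynomial.X 2 ^ (q - 1) :
      MvPolynomial (Fin 3) F) P.1) : f ∈ localRing P := by
  obtain ⟨g, ε, hg, rfl⟩ := mem_formSpace_iff.1 hV
  refine ⟨q - 1, g * MvPolynomial.X 0 ^ (q + 1 - m) + MvPolynomial.C ε *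
    (MvPolynomial.X 1 ^ (q - 1) + MvPolynomial.X 2 ^ (q - 1)), _, ?_,
    isHomogeneous_X_one_pow_add_X_two_pow F (q - 1), hP, ?_⟩
  · refine .add ?_ ?_
    · convert hg.mul (MvPolynomial.isHomogeneous_X_pow 0 (q + 1 - m)) using 1
      omega
    · exact (isHomogeneous_X_one_pow_add_X_two_pow F (q - 1)).C_mul ε
  · have := isDomain_coordRing hq F
    refine mul_right_cancel₀ (pow_ne_zero m (coordX_ne_zero (F := F) (by omega))) ?_
    have hx : coordX q F ^ (q + 1 - m) * coordX q F ^ m = coordY q F ^ q + coordY q F := by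
      rw [← pow_add, Nat.sub_add_cancel hmq, coordX_pow]
    have hy : coordY q F ^ (q - 1) * coordY q F = coordY q F ^ q := pow_sub_one_mul (by omega) _
    simp only [dehom, map_add, map_mul, map_pow, MvPolynomial.aeval_X, MvPolynomial.aeval_C,
      Matrix.cons_val_zero, Matrix.cons_val_one, Matrix.cons_val] at hf ⊢
    generalize MvPolynomial.aeval ![coordX q F, coordY q F, 1] g = γ at hf ⊢
    linear_combination (coordY q F ^ (q - 1) + 1) * hf - γ * hx + γ * hy

theorem exists_eq_affinePoint_of_vanishes [Fintype F] (hF : Fintype.card F = q ^ 2) (hq : 2 ≤ q)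
    {P : Point q F} (hX : Vanishes (MvPolynomial.X 0 : MvPolynomial (Fin 3) F) P.1)
    (hY : Vanishes (MvPolynomial.X 1 ^ (q - 1) + MvPolynomial.X 2 ^ (q - 1) :
      MvPolynomial (Fin 3) F) P.1) :
    ∃ (b : F) (h : b ^ q + b = 0 ^ (q + 1)), b ≠ 0 ∧ P = affinePoint q 0 b h := by
  obtain rfl | ⟨ψ, rfl⟩ := eq_infPoint_or_exists_eq_pointOf (by omega) P
  · rw [vanishes_infPoint_iff _ (isHomogeneous_X_one_pow_add_X_two_pow F (q - 1))] at hY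
    simp [show q - 1 ≠ 0 by omega] at hY
  have hx : ψ (ringX q F) = 0 := by
    simpa [ringDehom_X_zero] using (vanishes_pointOf_iff ψ (MvPolynomial.isHomogeneous_X F 0)).1 hX
  have hy : ψ (ringY q F) ^ (q - 1) + 1 = 0 := by
    simpa [ringDehom_X_one, ringDehom_X_two] using
      (vanishes_pointOf_iff ψ (isHomogeneous_X_one_pow_add_X_two_pow F (q - 1))).1 hY
  have hyq : ψ (ringY q F) ^ q = 0 - ψ (ringY q F) := by
    have hpow := pow_sub_one_mul (show q ≠ 0 by omega) (ψ (ringY q F))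
    linear_combination ψ (ringY q F) * hy - hpow
  obtain ⟨b, hb⟩ := mem_range_algebraMap_of_pow_card (F := F) (b := ψ (ringY q F)) (by
    rw [hF, sq, pow_mul, hyq, sub_pow_of_card_eq_pow two_ne_zero hF, hyq,
      zero_pow (by omega), sub_sub_cancel])
  have h : b ^ q + b = 0 ^ (q + 1) := by
    apply (algebraMap F (AlgebraicClosure F)).injective
    rw [map_add, map_pow, hb, hyq]
    simp
  refine ⟨b, h, ?_, ?_⟩
  · rintro rfl
    simp [← hb, show q - 1 ≠ 0 by omega] at hy
  · apply Subtype.ext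
    simp only [pointOf, affinePoint, affineProj, hx, ← hb, map_zero]

theorem mem_riemannRoch_divG_iff [Fintype F] [DecidableEq F] (hF : Fintype.card F = q ^ 2)
    (hq : 2 ≤ q) (hm : 2 ≤ m) (hmq : m ≤ q + 1) {f : FunField q F} :
    f ∈ riemannRoch (divG q F m) ↔ ∃ V ∈ formSpace F m, f * coordX q F ^ m = dehom q V := by
  refine ⟨exists_mem_formSpace_of_mem_riemannRoch hF hq hmq, fun ⟨V, hV, hf⟩ =>
    (mem_riemannRoch_divG_iff_forall hF hq).2 ⟨fun P hP => ?_, fun b h _ => ?_⟩⟩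
  · by_cases hX : Vanishes (MvPolynomial.X 0 : MvPolynomial (Fin 3) F) P.1
    · refine mem_localRing_of_not_vanishes_X_pow_add hq hm hmq hV hf fun hY => ?_
      obtain ⟨b, h, hb, rfl⟩ := exists_eq_affinePoint_of_vanishes hF hq hX hY
      exact hP b h hb rfl
    · exact mem_localRing_of_not_vanishes_X_zero (isHomogeneous_of_mem_formSpace hm hV) hf hX
  · rw [hf, ← algebraMap_ringDehom, affinePoint_eq_pointOf]
    exact algebraMap_mem_localRing _ _

end FormQuotients

/-! ### Evaluation of functions with poles on the line `X₁ = 0` -/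

section Code

theorem isMinDistance_of_card_zeros {n N : ℕ} {F : Type*} [Field F] [DecidableEq F]
    {C : Submodule F (Fin n → F)}
    (hle : ∀ w ∈ C, w ≠ 0 → (Finset.univ.filter fun i => w i = 0).card ≤ N)
    (heq : ∃ w ∈ C, w ≠ 0 ∧ (Finset.univ.filter fun i => w i = 0).card = N) :
    IsMinDistance C (n - N) := by
  have hnorm (w : Fin n → F) :
      hammingNorm w = n - (Finset.univ.filter fun i => w i = 0).card := by
    have h := Finset.card_filter_add_card_filter_not (s := Finset.univ) fun i => w i = 0
    rw [Finset.card_univ, Fintype.card_fin] at h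
    exact Nat.eq_sub_of_add_eq' h
  constructor
  · obtain ⟨w, hw, hw₀, rfl⟩ := heq
    exact ⟨w, hw, 0, C.zero_mem, hw₀, by rw [hammingDist_zero_right, hnorm]⟩
  · rintro e ⟨w, hw, w', hw', hne, rfl⟩
    rw [hammingDist_comm, hammingDist_eq_hammingNorm, neg_add_eq_sub, hnorm]
    exact Nat.sub_le_sub_left (hle _ (C.sub_mem hw hw') (sub_ne_zero.2 hne)) n

variable {q m n : ℕ} {F : Type*} [Field F]

theorem hasValue_affinePoint_iff {a b c : F} (h : b ^ q + b = a ^ (q + 1)) (ha : a ≠ 0)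
    {V : MvPolynomial (Fin 3) F} {f : FunField q F} (hf : f * coordX q F ^ m = dehom q V) :
    HasValue (affinePoint q a b h) f c ↔ c * a ^ m = MvPolynomial.eval ![a, b, 1] V := by
  have hx := algebraMap_ringX (q := q) (F := F)
  have hc := IsScalarTower.algebraMap_apply F (CoordRing q F) (FunField q F) c
  rw [HasValue, mem_maxIdeal_affinePoint_iff, ← evalHom_ringDehom h]
  constructor
  · rintro ⟨r, s, hs, hr, hrs⟩
    have hring : (ringDehom q V - algebraMap F _ c * ringX q F ^ m) * s = r * ringX q F ^ m := by
      apply algebraMap_coordRing_injective q F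
      simp only [map_mul, map_sub, map_pow, ← hc, hx, algebraMap_ringDehom, ← hf, ← hrs]
      ring
    have heval := congrArg (evalHom a b h) hring
    simp only [map_mul, map_sub, map_pow, AlgHom.commutes, evalHom_ringX, hr, zero_mul,
      mul_eq_zero, hs, or_false, sub_eq_zero] at heval
    exact heval.symm
  · intro hval
    refine ⟨ringDehom q V - algebraMap F _ c * ringX q F ^ m, ringX q F ^ m, ?_, ?_, ?_⟩
    · rw [map_pow, evalHom_ringX]
      exact pow_ne_zero m ha
    · simp [evalHom_ringX, ← hval]
    · simp only [map_mul, map_sub, map_pow, ← hc, hx, algebraMap_ringDehom, ← hf]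
      ring

theorem ncard_vanishes_affinePoint_le [DecidableEq F] {x y : Fin n → F}
    (h : ∀ i, y i ^ q + y i = x i ^ (q + 1))
    {V : MvPolynomial (Fin 3) F} {d : ℕ} (hV : V.IsHomogeneous d) :
    {P ∈ Set.range fun i => affinePoint q (x i) (y i) (h i) | Vanishes V P.1}.ncard ≤
      (Finset.univ.filter fun i => MvPolynomial.eval ![x i, y i, 1] V = 0).card := by
  have hsub : {P ∈ Set.range fun i => affinePoint q (x i) (y i) (h i) | Vanishes V P.1} ⊆
      (fun i => affinePoint q (x i) (y i) (h i)) ''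
        ↑(Finset.univ.filter fun i => MvPolynomial.eval ![x i, y i, 1] V = 0) := by
    rintro _ ⟨⟨i, rfl⟩, hi⟩
    exact ⟨i, by simpa using (vanishes_affinePoint_iff (h i) hV).1 hi, rfl⟩
  rw [← Set.ncard_coe_finset]
  exact (Set.ncard_le_ncard hsub (Set.toFinite _)).trans (Set.ncard_image_le (Set.toFinite _))

variable [Fintype F] [DecidableEq F] {x y : Fin n → F}

theorem mem_agCode_divG_iff (hF : Fintype.card F = q ^ 2) (hq : 2 ≤ q) (hm : 2 ≤ m)
    (hmq : m ≤ q + 1) (h : ∀ i, y i ^ q + y i = x i ^ (q + 1)) (hx : ∀ i, x i ≠ 0)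
    {w : Fin n → F} :
    w ∈ agCode (fun i => affinePoint q (x i) (y i) (h i)) (divG q F m) ↔
      ∃ V ∈ formSpace F m, ∀ i, w i * x i ^ m = MvPolynomial.eval ![x i, y i, 1] V := by
  constructor
  · rintro ⟨f, hf, hval⟩
    obtain ⟨V, hV, hfV⟩ := (mem_riemannRoch_divG_iff hF hq hm hmq).1 hf
    exact ⟨V, hV, fun i => (hasValue_affinePoint_iff (h i) (hx i) hfV).1 (hval i)⟩
  · rintro ⟨V, hV, hval⟩
    have := isDomain_coordRing hq F
    have hfV : dehom q V / coordX q F ^ m * coordX q F ^ m = dehom q V :=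
      div_mul_cancel₀ _ (pow_ne_zero m (coordX_ne_zero (by omega)))
    exact ⟨_, (mem_riemannRoch_divG_iff hF hq hm hmq).2 ⟨V, hV, hfV⟩,
      fun i => (hasValue_affinePoint_iff (h i) (hx i) hfV).2 (hval i)⟩

theorem isMinDistance_agCode_divG (hF : Fintype.card F = q ^ 2) (hq : 2 ≤ q) (hm : 2 ≤ m)
    (hmq : m ≤ q + 1) (h : ∀ i, y i ^ q + y i = x i ^ (q + 1)) (hx : ∀ i, x i ≠ 0) {N : ℕ}
    (hNn : N < n)
    (hle : ∀ V ∈ linearSystem F m,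
      (Finset.univ.filter fun i => MvPolynomial.eval ![x i, y i, 1] V = 0).card ≤ N)
    (heq : ∃ V ∈ linearSystem F m,
      (Finset.univ.filter fun i => MvPolynomial.eval ![x i, y i, 1] V = 0).card = N) :
    IsMinDistance (agCode (fun i => affinePoint q (x i) (y i) (h i)) (divG q F m)) (n - N) := by
  have hzero {V : MvPolynomial (Fin 3) F} {w : Fin n → F}
      (hw : ∀ i, w i * x i ^ m = MvPolynomial.eval ![x i, y i, 1] V) (i : Fin n) :
      w i = 0 ↔ MvPolynomial.eval ![x i, y i, 1] V = 0 := by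
    rw [← hw, mul_eq_zero_iff_right (pow_ne_zero m (hx i))]
  apply isMinDistance_of_card_zeros
  · intro w hw hw₀
    obtain ⟨V, hV, hwV⟩ := (mem_agCode_divG_iff hF hq hm hmq h hx).1 hw
    simp only [hzero hwV]
    refine hle V (mem_linearSystem_iff.2 ⟨?_, hV⟩)
    rintro rfl
    exact hw₀ (funext fun i => (hzero hwV i).2 (map_zero _))
  · obtain ⟨V, hV, hVN⟩ := heq
    have hw (i : Fin n) : MvPolynomial.eval ![x i, y i, 1] V / x i ^ m * x i ^ m =
        MvPolynomial.eval ![x i, y i, 1] V := div_mul_cancel₀ _ (pow_ne_zero m (hx i))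
    refine ⟨fun i => MvPolynomial.eval ![x i, y i, 1] V / x i ^ m,
      (mem_agCode_divG_iff hF hq hm hmq h hx).2 ⟨V, (mem_linearSystem_iff.1 hV).2, hw⟩, ?_, ?_⟩
    · intro h₀
      have hall (i : Fin n) : MvPolynomial.eval ![x i, y i, 1] V = 0 :=
        (hzero hw i).1 (congrFun h₀ i)
      simp [hall] at hVN
      omega
    · simpa only [hzero hw] using hVN

end Code

/-! ### The case `m = 3` -/

section Orbit

open MvPolynomial (X C eval)

theorem bijective_generator_pow_succ {G : Type*} [Group G] [Finite G] {g : G}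
    (hg : ∀ z, z ∈ Subgroup.zpowers g) {n : ℕ} (hn : Nat.card G = n) :
    Function.Bijective fun i : Fin n => g ^ ((i : ℕ) + 1) := by
  refine Function.Injective.bijective_of_nat_card_le (fun i j hij => ?_) (by simp [hn])
  have hord : orderOf g = n := (orderOf_eq_card_of_forall_mem_zpowers hg).trans hn
  refine Fin.ext (pow_injOn_Iio_orderOf (x := g) ?_ ?_ ?_)
  · simp [hord]
  · simp [hord]
  · exact mul_right_cancel (by simpa only [pow_succ] using hij)

theorem exists_eq_sum_of_isHomogeneous_one {σ R : Type*} [Fintype σ] [CommSemiring R]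
    {g : MvPolynomial σ R} (hg : g.IsHomogeneous 1) : ∃ c : σ → R, g = ∑ i, c i • X i := by
  rw [← MvPolynomial.mem_homogeneousSubmodule, MvPolynomial.homogeneousSubmodule_one_eq_span_X,
    Submodule.mem_span_range_iff_exists_fun] at hg
  exact hg.imp fun c hc => hc.symm

theorem card_filter_pow_eq_one {G : Type*} [CommGroup G] [IsCyclic G] [Fintype G] [DecidableEq G]
    {d : ℕ} (hd : d ∣ Nat.card G) : (Finset.univ.filter fun z : G => z ^ d = 1).card = d := by
  refine Eq.trans ?_ ((IsCyclic.card_powMonoidHom_ker (G := G) d).trans (Nat.gcd_eq_right hd))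
  rw [← Nat.card_eq_finsetCard]
  exact Nat.card_congr (Equiv.subtypeEquivRight fun z => by simp [MonoidHom.mem_ker])

theorem X_one_mul_X_two_mul_mem_linearSystem {F : Type*} [Field F] (v : F) :
    X 1 * X 2 * (X 1 - C v * X 2) ∈ linearSystem F 3 := by
  refine ⟨?_, X 1 - C v * X 2, 0, ?_, by simp⟩
  · refine mul_ne_zero (mul_ne_zero (MvPolynomial.X_ne_zero 1) (MvPolynomial.X_ne_zero 2)) ?_
    intro h
    simpa using congrArg (eval ![0, 1, 0]) h
  · exact (MvPolynomial.isHomogeneous_X F 1).sub ((MvPolynomial.isHomogeneous_X F 2).C_mul v)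

variable {q : ℕ} {F : Type*} [Field F] [Fintype F] [DecidableEq F] {u v : F}

theorem card_units_eval_eq_zero_le (hq : 4 ≤ q) (hF : Fintype.card F = q ^ 2) (hu : u ≠ 0)
    (hv : v ≠ 0) {V : MvPolynomial (Fin 3) F} (hV : V ∈ linearSystem F 3) :
    (Finset.univ.filter fun w : Fˣ =>
      eval ![(w : F) * u, (w : F) ^ (q + 1) * v, 1] V = 0).card ≤ q + 1 := by
  obtain ⟨hV₀, g, ε, hg, rfl⟩ := hV
  obtain ⟨c, rfl⟩ := exists_eq_sum_of_isHomogeneous_one hg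
  rw [← Finset.card_map ⟨Units.val, Units.val_injective⟩]
  refine card_le_of_forall_quadrinomial_eq_zero hq hF (A := c 2 * v) (B := c 0 * (u * v))
    (D := c 1 * v ^ 2) (E := ε * u ^ 3) ?_ ?_ ?_
  · simp only [mul_eq_zero, pow_eq_zero_iff, hu, hv, or_false, ne_eq, OfNat.ofNat_ne_zero,
      not_false_eq_true]
    rintro ⟨h₂, h₀, h₁, rfl⟩
    exact hV₀ (by simp [Fin.sum_univ_three, h₀, h₁, h₂])
  · simp
  · simp only [Finset.mem_map, Finset.mem_filter_univ, Function.Embedding.coeFn_mk]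
    rintro _ ⟨w, hw, rfl⟩
    rw [← hw]
    simp only [Fin.sum_univ_three, MvPolynomial.smul_eq_C_mul, map_add, map_mul, map_pow,
      MvPolynomial.eval_X, MvPolynomial.eval_C, Matrix.cons_val_zero, Matrix.cons_val_one,
      Matrix.cons_val]
    ring

/-- On the orbit the conic `X₂ (X₂ - v X₃) = 0` is cut out by `w^(q+1) = 1`. -/
theorem exists_card_units_eval_eq_zero (hF : Fintype.card F = q ^ 2) (u : F) (hv : v ≠ 0) :
    ∃ V ∈ linearSystem F 3, (Finset.univ.filter fun w : Fˣ =>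
      eval ![(w : F) * u, (w : F) ^ (q + 1) * v, 1] V = 0).card = q + 1 := by
  refine ⟨_, X_one_mul_X_two_mul_mem_linearSystem v, ?_⟩
  have hdvd : q + 1 ∣ Nat.card Fˣ := by
    rw [Nat.card_units, Nat.card_eq_fintype_card, hF, ← one_pow 2, Nat.sq_sub_sq]
    exact Dvd.intro _ rfl
  refine Eq.trans ?_ (card_filter_pow_eq_one hdvd)
  congr! 2 with w
  simp [hv, sub_eq_zero, Units.ext_iff]

theorem card_filter_generator_pow_succ (hF : Fintype.card F = q ^ 2) {ω : Fˣ}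
    (hω : ∀ z : Fˣ, z ∈ Subgroup.zpowers ω) (p : F → Prop) [DecidablePred p] :
    (Finset.univ.filter fun i : Fin (q ^ 2 - 1) => p ((ω : F) ^ ((i : ℕ) + 1))).card =
      (Finset.univ.filter fun w : Fˣ => p w).card :=
  Finset.card_bijective _ (bijective_generator_pow_succ hω
    (by rw [Nat.card_units, Nat.card_eq_fintype_card, hF])) (by simp)

end Orbit

end HermitianCode

open HermitianCode in
theorem proposition3 (q : ℕ) (hq : 4 ≤ q) (F : Type*) [Field F] [Fintype F] [DecidableEq F]
    (hF : Fintype.card F = q ^ 2)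
    (ω : Fˣ) (hω : ∀ z : Fˣ, z ∈ Subgroup.zpowers ω)
    (u v : F) (hu : u ≠ 0) (huv : v ^ q + v = u ^ (q + 1)) :
    HermitianCode.IsMinDistance
        (HermitianCode.agCode (HermitianCode.divD hF ω huv) (HermitianCode.divG q F 3))
        (q ^ 2 - q - 2) ∧
      q ^ 2 - q - 2 = q ^ 2 - 1 - (3 - 2) * (q + 1) ∧
      ∀ V ∈ HermitianCode.linearSystem F 3,
        {P ∈ Set.range (HermitianCode.divD hF ω huv) |
          HermitianCode.Vanishes V P.1}.ncard ≤ q + 1 := by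
  have hv : v ≠ 0 := by
    rintro rfl
    exact pow_ne_zero (q + 1) hu (by simpa [show q ≠ 0 by omega] using huv.symm)
  have hx (i : Fin (q ^ 2 - 1)) : (ω : F) ^ ((i : ℕ) + 1) * u ≠ 0 :=
    mul_ne_zero (pow_ne_zero _ ω.ne_zero) hu
  have hcard (V : MvPolynomial (Fin 3) F) := card_filter_generator_pow_succ hF hω fun w =>
    MvPolynomial.eval ![w * u, w ^ (q + 1) * v, 1] V = 0
  have hdist : q ^ 2 - q - 2 = q ^ 2 - 1 - (q + 1) := by omega
  refine ⟨?_, by omega, fun V hV => ?_⟩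
  · rw [hdist]
    refine isMinDistance_agCode_divG hF (by omega) (by omega) (by omega)
      (fun i => orbit_eq hF huv _) hx (Nat.lt_sub_of_add_lt (by nlinarith)) (fun V hV => ?_) ?_
    · exact (hcard V).trans_le (card_units_eval_eq_zero_le hq hF hu hv hV)
    · simpa only [hcard] using exists_card_units_eval_eq_zero hF u hv
  · exact (ncard_vanishes_affinePoint_le (fun i => orbit_eq hF huv _)
      (isHomogeneous_of_mem_formSpace le_add_self (mem_linearSystem_iff.1 hV).2)).trans
        ((hcard V).trans_le (card_units_eval_eq_zero_le hq hF hu hv hV))
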